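/- **Setting.** Let $\mathbf H$ be a function on $\omega$ with $|\mathbf H(m)|\ge 2$ for all $m$. A *creature* $t$ for $\mathbf H$ is a triple $(\mathrm{nor}[t],\mathrm{val}[t],\mathrm{dis}[t])$ with $\mathrm{nor}[t]\in\mathbb R^{\ge 0}$, $\mathrm{dis}[t]$ an arbitrary parameter, and $\mathrm{val}[t]$ a non-empty set of pairs $\langle x,y\rangle$ with $x$ a proper initial segment of $y$, where, for some numbers $m^t_{\rm dn}<m^t_{\rm up}$, always $x\in\prod_{i<m^t_{\rm dn}}\mathbf H(i)$ and $y\in\prod_{i<m^t_{\rm up}}\mathbf H(i)$. Call $t_0,\dots,t_n$ *linked* if $m^{t_i}_{\rm up}=m^{t_{i+1}}_{\rm dn}$ for $i<n$; for linked sequences write $\Sigma(t_0,\dots,t_n)$ for $\Sigma(\{t_0,\dots,t_n\})$, and similarly for $\mathrm{pos}$. A *creating pair* $(K,\Sigma)$ for $\mathbf H$ consists of a set $K$ of creatures and a map $\Sigma:[K]^{\le\omega}\to\mathcal P(K)$ such that $\Sigma(\emptyset)=\emptyset$; $r\in\Sigma(r)$ for $r\in K$; if $s\in\Sigma(\mathcal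 S_s)$ for all $s\in\mathcal S$ then $\Sigma(\mathcal S)\subseteq\Sigma(\bigcup_{s\in\mathcal S}\mathcal S_s)$; if $\Sigma(\mathcal S)\ne\emptyset$ then $\mathcal S$ is finite and can be enumerated as a linked sequence; and if $s\in\Sigma(t_0,\dots,t_n)$ (with $t_0,\dots,t_n$ linked) then $m^s_{\rm dn}=m^{t_0}_{\rm dn}$ and $m^s_{\rm up}=m^{t_n}_{\rm up}$. Put $\mathrm{basis}(t)=\{x:\exists s\in\Sigma(t)\,\exists u\ \langle x,u\rangle\in\mathrm{val}[s]\}$, $\mathrm{pos}^*(x,\mathcal S)=\{u:\exists s\in\Sigma(\mathcal S)\ \langle x,u\rangle\in\mathrm{val}[s]\}$, and let $\mathrm{pos}(x,\mathcal S)$ be the set of those $u$ for which there are pairwise disjoint $\mathcal S_0,\dots,\mathcal S_{m-1}$ with union $\mathcal S$ and $x=u_0,u_1,\dots,u_m=u$ with $u_{i+1}\in\mathrm{pos}^*(u_i,\mathcal S_i)$ for $i<m$ (so $\mathrm{pos}(x,\emptyset)=\{x\}$). A *finite candidate* is $(x,t_0,\dots,t_n)$ with $t_0,\dots,t_n\in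 K$ linked, $x\in\mathrm{basis}(t_0)$ and $\mathrm{pos}(x,t_0,\dots,t_i)\subseteq\mathrm{basis}(t_{i+1})$ for $i<n$; then $(t_0,\dots,t_n)$ is a *pure finite candidate*. Creating pairs are always assumed to be *nice* ($s\in\Sigma(t_0,\dots,t_n)$ implies $\mathrm{basis}(t_0)\subseteq\mathrm{basis}(s)$) and *smooth* (if $(x,t_0,\dots,t_{n-1})$ is a finite candidate, $m<n$ and $u\in\mathrm{pos}(x,t_0,\dots,t_{n-1})$, then $u{\restriction}m^{t_m}_{\rm dn}\in\mathrm{pos}(x,t_0,\dots,t_{m-1})$ and $u\in\mathrm{pos}(u{\restriction}m^{t_m}_{\rm dn},t_m,\dots,t_{n-1})$). The pair $(K,\Sigma)$ is * *finitary* if all $\mathbf H(n)$ and all $\mathrm{val}[t]$, $t\in K$, are finite; * *$\bar 2$-big* if for all $t\in K$ with $\mathrm{nor}[t]>1$, $u\in\mathrm{basis}(t)$ and $c:\mathrm{pos}(u,t)\to 2$ there is $s\in\Sigma(t)$ with $\mathrm{nor}[s]\ge\mathrm{nor}[t]-1$ and $c{\restriction}\mathrm{pos}(u,s)$ constant; *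 *simple* if $\Sigma(\mathcal S)\neq\emptyset$ only for singletons $\mathcal S$; * *gluing* if $\{x:\exists u\ \langle x,u\rangle\in\mathrm{val}[t]\}=\prod_{i<m^t_{\rm dn}}\mathbf H(i)$ for all $t\in K$, and for every $k<\omega$ there is $n_0$ such that for every $n\ge n_0$ and every pure finite candidate $(t_0,\dots,t_n)$ there is $s\in\Sigma(t_0,\dots,t_n)$ with $\mathrm{nor}[s]\ge\min\{k,\mathrm{nor}[t_0],\dots,\mathrm{nor}[t_n]\}$. It has the *Halving Property* if there is $\mathrm{half}:K\to K$ with $\mathrm{half}(t)\in\Sigma(t)$ and $\mathrm{nor}[\mathrm{half}(t)]\ge\frac12\mathrm{nor}[t]$ for all $t\in K$, such that whenever $t_0,\dots,t_n\in K$ are linked and have norms $\ge2$, $t\in\Sigma(\mathrm{half}(t_0),\dots,\mathrm{half}(t_n))$ and $\mathrm{nor}[t]>0$, there is $s\in\Sigma(t_0,\dots,t_n)$ with $\mathrm{nor}[s]\ge\min_{i\le n}\frac12\mathrm{nor}[t_i]$ and $\mathrm{pos}(u,s)\subseteq\mathrm{pos}(u,t)$ for all $u\in\mathrm{basis}(t_0)$.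 A function $f:\omega\times\omega\to\omega$ is *$\mathbf H$-fast* if $\mathbf H$ is finitary and for all $k,\ell$: $f(k,\ell)\le f(k,\ell+1)$, $2f(k,\ell)<f(k+1,\ell)$ and $2^{\varphi(\ell)}(f(k,\ell)+\varphi(\ell)+2)<f(k+1,\ell)$, where $\varphi(\ell)=|\prod_{i<\ell}\mathbf H(i)|$. Conditions of $\mathbb Q^*_f(K,\Sigma)$ are the sequences $p=(w^p,t^p_0,t^p_1,\dots)$ such that all $t^p_i\in K$, $m^{t^p_i}_{\rm up}=m^{t^p_{i+1}}_{\rm dn}$, $w^p\in\mathrm{basis}(t^p_0)$, for every $I\subseteq\omega$ and $u\in\mathrm{pos}(w^p,\{t^p_i:i\in I\})$ there is $i\notin I$ with $u\in\mathrm{basis}(t^p_i)$, and for every $k$, $\mathrm{nor}[t^p_i]>f(k,m^{t^p_i}_{\rm dn})$ for all but finitely many $i$. The order (larger is stronger) is: $p\le q$ iff there are pairwise disjoint $S_0,S_1,\dots\subseteq\omega$ with $w^q\in\mathrm{pos}(w^p,\{t^p_\ell:\ell\in S_0\})$ and $t^q_i\in\Sigma(\{t^p_\ell:\ell\in S_{i+1}\})$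 for all $i$. Further, $p\le^f_0q$ iff $p\le q$ and $w^p=w^q$; and $p\le^f_{n+1}q$ iff $p\le^f_0q$, $t^p_j=t^q_j$ for all $j\le\min\{i:\mathrm{nor}[t^p_i]>f(n+1,m^{t^p_i}_{\rm dn})\}$, and $\{t^q_i:\mathrm{nor}[t^q_i]\le f(n+1,m^{t^q_i}_{\rm dn})\}\subseteq\{t^p_i:i<\omega\}$. A condition $p$ *essentially decides* a name $\dot\tau$ for an ordinal if for some $m$ and all $u\in\mathrm{pos}(w^p,t^p_0,\dots,t^p_{m-1})$ the condition $(u,t^p_m,t^p_{m+1},\dots)$ decides the value of $\dot\tau$. A forcing notion $\mathbb P$ is *proper* if for club many countable $N\subseteq\mathbb P\cup\mathcal P(\mathbb P)$, every $p\in\mathbb P\cap N$ has an extension $q\ge p$ that is $(N,\mathbb P)$-generic, i.e. for each dense $D\subseteq\mathbb P$ with $D\in N$, the set $D\cap N$ is predense above $q$. **Theorem.** Let $(K,\Sigma)$ be a finitary, $\bar2$-big creating pair for $\mathbf H$ with the Halving Property which is simple or gluing, and let $f:\omega\times\omega\to\omega$ be $\mathbf H$-fast. Then: 1. for all $\mathbb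 Q^*_f(K,\Sigma)$-names $\dot\tau_m$ ($m<\omega$) for ordinals, all $p\in\mathbb Q^*_f(K,\Sigma)$ and all $n<\omega$ there is $q\in\mathbb Q^*_f(K,\Sigma)$ such that $p\le^f_nq$ and $q$ essentially decides every $\dot\tau_m$; 2. the forcing notion $\mathbb Q^*_f(K,\Sigma)$ is proper. -/

import Mathlib

/-! # Creating pairs, the forcing notions `Q*_f(K, Σ)`, and properness -/

universe u v w

namespace Creatures

section Sequences

variable {α : Type u}

/-- `w` is an element of `∏_{i < m} H(i)`, where `m` is the length of `w`. -/
def IsSeq (H : ℕ → Set α) (w : List α) : Prop :=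
  ∀ (i : ℕ) (h : i < w.length), w[i] ∈ H i

/-- `φ_H(l)`, the number of elements of `∏_{i < l} H(i)`. -/
noncomputable def phi (H : ℕ → Set α) (l : ℕ) : ℕ :=
  Set.ncard {w : List α | IsSeq H w ∧ w.length = l}

/-- Each `H(n)` is finite. -/
def IsFinitarySeq (H : ℕ → Set α) : Prop :=
  ∀ n, (H n).Finite

/-- `f` is fast. -/
def IsFast (f : ℕ → ℕ → ℕ) : Prop :=
  ∀ k l, f k l ≤ f k (l + 1) ∧ 2 * f k l < f (k + 1) l

/-- `f` is `H`-fast. -/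
def IsHFast (H : ℕ → Set α) (f : ℕ → ℕ → ℕ) : Prop :=
  IsFast f ∧ IsFinitarySeq H ∧
    ∀ k l, 2 ^ phi H l * (f k l + phi H l + 2) < f (k + 1) l

/-- A weak creature for `H`: a triple `(nor, val, dis)`.  The type `D` holds the
distinguishing parameters `dis`. -/
@[ext] structure WeakCreature (H : ℕ → Set α) (D : Type v) where
  nor : ℝ
  val : Set (List α × List α)
  dis : D
  nor_nonneg : 0 ≤ nor
  val_nonempty : val.Nonempty
  val_spec : ∀ x ∈ val, IsSeq H x.1 ∧ IsSeq H x.2 ∧ x.1 <+: x.2 ∧ x.1.length < x.2.length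

end Sequences

section Creature

variable {α : Type u} {H : ℕ → Set α} {D : Type v}

/-- `m_dn(t)`, the least length of an element of `dom(val[t])`. -/
noncomputable def WeakCreature.mdn (t : WeakCreature H D) : ℕ :=
  sInf ((fun x : List α × List α => x.1.length) '' t.val)

/-- `m_up(t)`, the least length of an element of `rng(val[t])`. -/
noncomputable def WeakCreature.mup (t : WeakCreature H D) : ℕ :=
  sInf ((fun x : List α × List α => x.2.length) '' t.val)

/-- `t` is a creature: all elements of `dom(val[t])` have the same length `m_dn`, and all
elements of `rng(val[t])` have the same length `m_up`. -/
def WeakCreature.IsCreature (t : WeakCreature H D) : Prop :=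
  ∀ x ∈ t.val, x.1.length = t.mdn ∧ x.2.length = t.mup

theorem WeakCreature.IsCreature.mdn_lt_mup {t : WeakCreature H D} (h : t.IsCreature) :
    t.mdn < t.mup := by
  obtain ⟨x, hx⟩ := t.val_nonempty
  have h1 := h x hx
  have h2 := (t.val_spec x hx).2.2.2
  omega

/-- The basis of `t` with respect to the operation `Sg`. -/
def basis (Sg : Set (WeakCreature H D) → Set (WeakCreature H D)) (t : WeakCreature H D) :
    Set (List α) :=
  {x | ∃ s ∈ Sg {t}, ∃ u, (x, u) ∈ s.val}

/-- `pos*(x, S)` with respect to the operation `Sg`. -/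
def posStar (Sg : Set (WeakCreature H D) → Set (WeakCreature H D)) (x : List α)
    (S : Set (WeakCreature H D)) : Set (List α) :=
  {u | ∃ s ∈ Sg S, (x, u) ∈ s.val}

/-- `IsPos Sg x S u` says that `S` is the union of finitely many pairwise disjoint sets
`S_0, …, S_{m-1}` for which there are `x = u_0, u_1, …, u_m = u` with
`u_{i+1} ∈ pos*(u_i, S_i)` for `i < m`.  (Each `u_i` is then an initial segment of `u`, and
the lengths of the `u_i` are strictly increasing.)  For `m = 0` this reads
`S = ∅` and `u = x`. -/
inductive IsPos (Sg : Set (WeakCreature H D) → Set (WeakCreature H D)) :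
    List α → Set (WeakCreature H D) → List α → Prop
  | nil (x : List α) : IsPos Sg x ∅ x
  | cons {x y u : List α} {A S : Set (WeakCreature H D)} :
      y ∈ posStar Sg x A → Disjoint A S → IsPos Sg y S u → IsPos Sg x (A ∪ S) u

/-- `pos(x, S)`, the set of possible extensions of `x` from the point of view of `S`. -/
def pos (Sg : Set (WeakCreature H D) → Set (WeakCreature H D)) (x : List α)
    (S : Set (WeakCreature H D)) : Set (List α) :=
  {u | IsPos Sg x S u}

/-- The set `{t_m, …, t_{n-1}}`. -/
def seg (t : ℕ → WeakCreature H D) (m n : ℕ) : Set (WeakCreature H D) :=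
  t '' Set.Ico m n

/-- `t_0, …, t_{n-1}` are elements of `K`, and `m_up(t_i) = m_dn(t_{i+1})` for `i + 1 < n`. -/
def IsLinked (K : Set (WeakCreature H D)) (t : ℕ → WeakCreature H D) (n : ℕ) : Prop :=
  (∀ i < n, t i ∈ K) ∧ ∀ i, i + 1 < n → (t i).mup = (t (i + 1)).mdn

/-- `(x, t_0, …, t_{n-1})` is a finite candidate (where `n ≥ 1`). -/
def IsFC (K : Set (WeakCreature H D)) (Sg : Set (WeakCreature H D) → Set (WeakCreature H D))
    (x : List α) (t : ℕ → WeakCreature H D) (n : ℕ) : Prop :=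
  1 ≤ n ∧ IsLinked K t n ∧ x ∈ basis Sg (t 0) ∧
    ∀ i, i + 1 < n → pos Sg x (seg t 0 (i + 1)) ⊆ basis Sg (t (i + 1))

/-- `(t_0, …, t_{n-1})` is a pure finite candidate (where `n ≥ 1`). -/
def IsPFC (K : Set (WeakCreature H D)) (Sg : Set (WeakCreature H D) → Set (WeakCreature H D))
    (t : ℕ → WeakCreature H D) (n : ℕ) : Prop :=
  ∃ x ∈ basis Sg (t 0), IsFC K Sg x t n

end Creature

/-- A creating pair `(K, Σ)` for `H`, which is nice and smooth.  The operation `Sg` stands for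
`Σ`; only its values at countable subsets of `K` are relevant. -/
structure CreatingPair {α : Type u} (H : ℕ → Set α) (D : Type v) where
  /-- the family of creatures -/
  K : Set (WeakCreature H D)
  /-- the composition operation -/
  Sg : Set (WeakCreature H D) → Set (WeakCreature H D)
  creature : ∀ t ∈ K, t.IsCreature
  Sg_subset : ∀ S ⊆ K, S.Countable → Sg S ⊆ K
  /-- transitivity -/
  Sg_trans : ∀ S ⊆ K, S.Countable → ∀ T : WeakCreature H D → Set (WeakCreature H D),
    (∀ s ∈ S, T s ⊆ K ∧ (T s).Countable ∧ s ∈ Sg (T s)) → Sg S ⊆ Sg (⋃ s ∈ S, T s)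
  Sg_self : ∀ r ∈ K, r ∈ Sg {r}
  Sg_empty : Sg ∅ = ∅
  /-- `Σ(S)` can be non-empty only for finite `S` which can be enumerated as a linked
  sequence -/
  Sg_linked : ∀ S ⊆ K, S.Countable → (Sg S).Nonempty →
    ∃ (n : ℕ) (t : ℕ → WeakCreature H D), S = seg t 0 n ∧ IsLinked K t n
  Sg_ends : ∀ (n : ℕ) (t : ℕ → WeakCreature H D), IsLinked K t (n + 1) →
    ∀ s ∈ Sg (seg t 0 (n + 1)), s.mdn = (t 0).mdn ∧ s.mup = (t n).mup
  nice : ∀ (n : ℕ) (t : ℕ → WeakCreature H D), IsLinked K t (n + 1) →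
    ∀ s ∈ Sg (seg t 0 (n + 1)), basis Sg (t 0) ⊆ basis Sg s
  smooth : ∀ (x : List α) (n : ℕ) (t : ℕ → WeakCreature H D), IsFC K Sg x t n →
    ∀ m < n, ∀ u ∈ pos Sg x (seg t 0 n),
      u.take (t m).mdn ∈ pos Sg x (seg t 0 m) ∧
        u ∈ pos Sg (u.take (t m).mdn) (seg t m n)

section Properties

variable {α : Type u} {H : ℕ → Set α} {D : Type v} (P : CreatingPair H D)

/-- `(K, Σ)` is finitary. -/
def CreatingPair.IsFinitary : Prop :=
  IsFinitarySeq H ∧ ∀ t ∈ P.K, t.val.Finite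

/-- `K` is full. -/
def CreatingPair.IsFull : Prop :=
  ∀ t ∈ P.K, {x : List α | ∃ u, (x, u) ∈ t.val} = {x | IsSeq H x ∧ x.length = t.mdn}

/-- `(K, Σ)` is simple. -/
def CreatingPair.IsSimple : Prop :=
  ∀ S ⊆ P.K, S.Countable → (P.Sg S).Nonempty → ∃ t, S = {t}

/-- `(K, Σ)` is gluing.  The last line says that
`nor[s] ≥ min {k, nor[t_0], …, nor[t_n]}`. -/
def CreatingPair.IsGluing : Prop :=
  P.IsFull ∧ ∀ k : ℕ, ∃ n₀ : ℕ, ∀ n ≥ n₀, ∀ t : ℕ → WeakCreature H D,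
    IsPFC P.K P.Sg t (n + 1) → ∃ s ∈ P.Sg (seg t 0 (n + 1)),
      (k : ℝ) ≤ s.nor ∨ ∃ i ≤ n, (t i).nor ≤ s.nor

/-- `(K, Σ)` is `r`-big, for a sequence `r` of integers. -/
def CreatingPair.IsBig (r : ℕ → ℕ) : Prop :=
  ∀ t ∈ P.K, 1 < t.nor → ∀ u ∈ basis P.Sg t, ∀ c : pos P.Sg u {t} → Fin (r t.mdn),
    ∃ s ∈ P.Sg {t}, t.nor - 1 ≤ s.nor ∧
      ∃ a, ∀ x : pos P.Sg u {t}, (x : List α) ∈ pos P.Sg u {s} → c x = a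

/-- `(K, Σ)` has the Halving Property.  The condition `∃ i ≤ n, (t i).nor / 2 ≤ s.nor` says that
`nor[s] ≥ min {nor[t_i] / 2 : i ≤ n}`. -/
def CreatingPair.HasHalving : Prop :=
  ∃ half : WeakCreature H D → WeakCreature H D,
    (∀ t ∈ P.K, half t ∈ P.Sg {t} ∧ t.nor / 2 ≤ (half t).nor) ∧
    ∀ (n : ℕ) (t : ℕ → WeakCreature H D), IsLinked P.K t (n + 1) → (∀ i ≤ n, 2 ≤ (t i).nor) →
      ∀ t' ∈ P.Sg (seg (fun i => half (t i)) 0 (n + 1)), 0 < t'.nor →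
        ∃ s ∈ P.Sg (seg t 0 (n + 1)), (∃ i ≤ n, (t i).nor / 2 ≤ s.nor) ∧
          ∀ u ∈ basis P.Sg (t 0), pos P.Sg u {s} ⊆ pos P.Sg u {t'}

end Properties

section Forcing

variable {α : Type u} {H : ℕ → Set α} {D : Type v}

/-- The conditions `(stem, t_0, t_1, …)` of the forcing notion `Q*_C(K, Σ)` determined by a
property `C` of sequences of creatures. -/
@[ext] structure QStar (P : CreatingPair H D) (C : (ℕ → WeakCreature H D) → Prop) where
  stem : List α
  t : ℕ → WeakCreature H D
  t_mem : ∀ i, t i ∈ P.K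
  stem_mem : stem ∈ basis P.Sg (t 0)
  pos_mem : ∀ (I : Set ℕ), ∀ u ∈ pos P.Sg stem (t '' I), ∃ i, i ∉ I ∧ u ∈ basis P.Sg (t i)
  link : ∀ i, (t i).mup = (t (i + 1)).mdn
  norm_cond : C t

/-- The order of `Q*_C(K, Σ)`; the larger condition is the stronger one. -/
def QStar.IsLE {P : CreatingPair H D} {C : (ℕ → WeakCreature H D) → Prop}
    (p q : QStar P C) : Prop :=
  ∃ (S₀ : Set ℕ) (S : ℕ → Set ℕ),
    (∀ i, Disjoint S₀ (S i)) ∧ (∀ i j, i ≠ j → Disjoint (S i) (S j)) ∧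
    q.stem ∈ pos P.Sg p.stem (p.t '' S₀) ∧ ∀ i, q.t i ∈ P.Sg (p.t '' S i)

theorem QStar.mdn_lt_mdn {P : CreatingPair H D} {C : (ℕ → WeakCreature H D) → Prop}
    (p : QStar P C) : StrictMono fun i => (p.t i).mdn := by
  refine strictMono_nat_of_lt_succ fun i => ?_
  rw [← p.link i]
  exact (P.creature _ (p.t_mem i)).mdn_lt_mup

theorem QStar.t_injective {P : CreatingPair H D} {C : (ℕ → WeakCreature H D) → Prop}
    (p : QStar P C) : Function.Injective p.t := fun i j hij =>
  p.mdn_lt_mdn.injective (by simp only [hij])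

theorem IsPos.trans {Sg : Set (WeakCreature H D) → Set (WeakCreature H D)} {x y z : List α}
    {S T : Set (WeakCreature H D)} (h : IsPos Sg x S y) (h' : IsPos Sg y T z)
    (hd : Disjoint S T) : IsPos Sg x (S ∪ T) z := by
  induction h with
  | nil x => simpa using h'
  | @cons x y u A S hy hAS _ ih =>
    rw [Set.disjoint_union_left] at hd
    rw [Set.union_assoc]
    exact IsPos.cons hy (Set.disjoint_union_right.2 ⟨hAS, hd.1⟩) (ih h' hd.2)

theorem IsPos.coarsen (P : CreatingPair H D) {x u : List α} {S : Set (WeakCreature H D)}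
    (h : IsPos P.Sg x S u) (T : WeakCreature H D → Set (WeakCreature H D))
    (hS : S ⊆ P.K) (hc : S.Countable)
    (hT : ∀ s ∈ S, T s ⊆ P.K ∧ (T s).Countable ∧ s ∈ P.Sg (T s))
    (hd : ∀ s ∈ S, ∀ s' ∈ S, s ≠ s' → Disjoint (T s) (T s')) :
    IsPos P.Sg x (⋃ s ∈ S, T s) u := by
  induction h with
  | nil x => simpa using IsPos.nil x
  | @cons x y u A S hy hAS _ ih =>
    rw [Set.biUnion_union]
    obtain ⟨s, hs, hxy⟩ := hy
    refine IsPos.cons ⟨s, ?_, hxy⟩ ?_ (ih (fun a ha => hS (Or.inr ha))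
      (hc.mono Set.subset_union_right) (fun a ha => hT a (Or.inr ha))
      (fun a ha b hb => hd a (Or.inr ha) b (Or.inr hb)))
    · exact P.Sg_trans A (fun a ha => hS (Or.inl ha)) (hc.mono Set.subset_union_left) T
        (fun a ha => hT a (Or.inl ha)) hs
    · simp only [Set.disjoint_iUnion_left, Set.disjoint_iUnion_right]
      intro a ha b hb
      refine hd _ (by tauto) _ (by tauto) ?_
      rintro rfl
      exact Set.disjoint_left.1 hAS (by assumption) (by assumption)

theorem QStar.IsLE.refl {P : CreatingPair H D} {C : (ℕ → WeakCreature H D) → Prop}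
    (p : QStar P C) : p.IsLE p := by
  refine ⟨∅, fun i => {i}, by simp, by simp, ?_, fun i => ?_⟩
  · rw [Set.image_empty]
    exact IsPos.nil p.stem
  · simpa using P.Sg_self _ (p.t_mem i)

theorem QStar.IsLE.trans {P : CreatingPair H D} {C : (ℕ → WeakCreature H D) → Prop}
    {p q r : QStar P C} (hpq : p.IsLE q) (hqr : q.IsLE r) : p.IsLE r := by
  obtain ⟨S₀, S, hS₀, hS, hst, ht⟩ := hpq
  obtain ⟨R₀, R, hR₀, hR, hst', ht'⟩ := hqr
  have hp : ∀ A : Set ℕ, p.t '' A ⊆ P.K := by rintro A _ ⟨i, _, rfl⟩; exact p.t_mem i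
  have hq : ∀ A : Set ℕ, q.t '' A ⊆ P.K := by rintro A _ ⟨i, _, rfl⟩; exact q.t_mem i
  have hcp : ∀ A : Set ℕ, (p.t '' A).Countable := fun A => A.to_countable.image _
  have hcq : ∀ A : Set ℕ, (q.t '' A).Countable := fun A => A.to_countable.image _
  have hdis : ∀ A B : Set ℕ, Disjoint A B → Disjoint (p.t '' A) (p.t '' B) := fun A B h =>
    (Set.disjoint_image_iff p.t_injective).2 h
  set T : WeakCreature H D → Set (WeakCreature H D) :=
    fun s => p.t '' S (Function.invFun q.t s) with hT
  have hTq : ∀ i, T (q.t i) = p.t '' S i := fun i => by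
    simp only [hT, Function.leftInverse_invFun q.t_injective i]
  have hU : ∀ A : Set ℕ, (⋃ s ∈ q.t '' A, T s) = p.t '' ⋃ i ∈ A, S i := fun A => by
    rw [Set.biUnion_image, Set.image_iUnion₂]
    exact Set.iUnion₂_congr fun i _ => hTq i
  have hTs : ∀ A : Set ℕ, ∀ s ∈ q.t '' A, T s ⊆ P.K ∧ (T s).Countable ∧ s ∈ P.Sg (T s) := by
    rintro A _ ⟨i, _, rfl⟩
    rw [hTq]
    exact ⟨hp _, hcp _, ht i⟩
  refine ⟨S₀ ∪ ⋃ i ∈ R₀, S i, fun n => ⋃ i ∈ R n, S i, fun n => ?_, fun m n hmn => ?_, ?_,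
    fun n => ?_⟩
  · rw [Set.disjoint_union_left]
    simp only [Set.disjoint_iUnion_left, Set.disjoint_iUnion_right]
    refine ⟨fun i _ => hS₀ i, fun i hi j hj => hS _ _ ?_⟩
    rintro rfl
    exact Set.disjoint_left.1 (hR₀ n) (by assumption) (by assumption)
  · simp only [Set.disjoint_iUnion_left, Set.disjoint_iUnion_right]
    intro i hi j hj
    refine hS _ _ ?_
    rintro rfl
    exact Set.disjoint_left.1 (hR m n hmn) (by assumption) (by assumption)
  · rw [Set.image_union, ← hU R₀]
    refine IsPos.trans hst (IsPos.coarsen P hst' T (hq _) (hcq _) (hTs _) ?_) ?_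
    · rintro _ ⟨i, _, rfl⟩ _ ⟨j, _, rfl⟩ hij
      rw [hTq, hTq]
      exact hdis _ _ (hS _ _ fun h => hij (by rw [h]))
    · rw [hU]
      refine hdis _ _ ?_
      simp only [Set.disjoint_iUnion_right]
      exact fun i _ => hS₀ i
  · rw [← hU]
    exact P.Sg_trans _ (hq _) (hcq _) T (hTs _) (ht' n)

instance {P : CreatingPair H D} {C : (ℕ → WeakCreature H D) → Prop} :
    Preorder (QStar P C) where
  le := QStar.IsLE
  le_refl := QStar.IsLE.refl
  le_trans _ _ _ := QStar.IsLE.trans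

/-- The norm condition `C^f(nor)`. -/
def NormCond (H : ℕ → Set α) (D : Type v) (f : ℕ → ℕ → ℕ) (t : ℕ → WeakCreature H D) : Prop :=
  ∀ k : ℕ, ∀ᶠ i in Filter.atTop, (f k (t i).mdn : ℝ) < (t i).nor

/-- The forcing notion `Q*_f(K, Σ)`. -/
abbrev QF (P : CreatingPair H D) (f : ℕ → ℕ → ℕ) : Type (max u v) :=
  QStar P (NormCond H D f)

/-- The relation `p ≤^f_n q` on `Q*_f(K, Σ)`.  (The set of which the least element is taken is
non-empty by the norm condition.) -/
def QF.LEn {P : CreatingPair H D} {f : ℕ → ℕ → ℕ} : ℕ → QF P f → QF P f → Prop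
  | 0, p, q => p ≤ q ∧ p.stem = q.stem
  | n + 1, p, q => (p ≤ q ∧ p.stem = q.stem) ∧
      (∀ j ≤ sInf {i : ℕ | (f (n + 1) (p.t i).mdn : ℝ) < (p.t i).nor}, p.t j = q.t j) ∧
      ∀ i, (q.t i).nor ≤ (f (n + 1) (q.t i).mdn : ℝ) → q.t i ∈ Set.range p.t

end Forcing

section Names

/-- A name for an ordinal, with respect to a forcing notion `Q` in which larger conditions are
stronger.  It is given by a set of pairs `(a, o)`; in the extension by a generic filter `G` it
denotes the ordinal `o` for which there is some `(a, o)` in this set with `a ∈ G`.  The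
two conditions say that it is forced that there is exactly one such `o`. -/
structure OrdName (Q : Type u) [Preorder Q] where
  pairs : Set (Q × Ordinal.{w})
  exists_value : ∀ p : Q, ∃ r, p ≤ r ∧ ∃ x ∈ pairs, x.1 ≤ r
  value_unique : ∀ x ∈ pairs, ∀ y ∈ pairs, (∃ r, x.1 ≤ r ∧ y.1 ≤ r) → x.2 = y.2

variable {Q : Type u} [Preorder Q]

/-- `p` forces that the value of the name is `o`: densely many conditions above `p` are above some
`a` with `(a, o)` in the name. -/
def OrdName.Forces (τ : OrdName.{u, w} Q) (p : Q) (o : Ordinal.{w}) : Prop :=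
  ∀ q, p ≤ q → ∃ r, q ≤ r ∧ ∃ a ≤ r, (a, o) ∈ τ.pairs

/-- `p` decides the value of the name. -/
def OrdName.DecidedBy (τ : OrdName.{u, w} Q) (p : Q) : Prop :=
  ∃ o, τ.Forces p o

/-- `C` is a club of countable subsets of `X`. -/
def IsCountableClub {X : Type u} (C : Set (Set X)) : Prop :=
  (∀ A ∈ C, A.Countable) ∧ (∀ A : Set X, A.Countable → ∃ B ∈ C, A ⊆ B) ∧
    ∀ A : ℕ → Set X, Monotone A → (∀ n, A n ∈ C) → (⋃ n, A n) ∈ C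

/-- `D` is dense in `Q`. -/
def IsDenseSet (D : Set Q) : Prop :=
  ∀ p, ∃ d ∈ D, p ≤ d

/-- For a set `N` of conditions and of sets of conditions, `q` is `(N, Q)`-generic:
for each dense `D ∈ N`, the set `D ∩ N` is predense above `q`. -/
def IsGenericFor (N : Set (Q ⊕ Set Q)) (q : Q) : Prop :=
  ∀ D : Set Q, Sum.inr D ∈ N → IsDenseSet D →
    ∀ r, q ≤ r → ∃ d ∈ D, Sum.inl d ∈ N ∧ ∃ s, r ≤ s ∧ d ≤ s

/-- `Q` is proper: for club many countable `N ⊆ Q ∪ 𝒫(Q)`, each condition in `N` has an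
`(N, Q)`-generic extension. -/
def IsProperForcing (Q : Type u) [Preorder Q] : Prop :=
  ∃ C : Set (Set (Q ⊕ Set Q)), IsCountableClub C ∧
    ∀ N ∈ C, ∀ p : Q, Sum.inl p ∈ N → ∃ q, p ≤ q ∧ IsGenericFor N q

end Names

section Deciding

variable {α : Type u} {H : ℕ → Set α} {D : Type v}

/-- `p` essentially decides `τ`: for some `m`, for all `x ∈ pos(w^p, t^p_0, …, t^p_{m-1})`, the
condition `(x, t^p_m, t^p_{m+1}, …)` decides the value of `τ`. -/
def QStar.EssentiallyDecides {P : CreatingPair H D} {C : (ℕ → WeakCreature H D) → Prop}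
    (p : QStar P C) (τ : OrdName.{max u v, w} (QStar P C)) : Prop :=
  ∃ m, ∀ x ∈ pos P.Sg p.stem (seg p.t 0 m),
    ∃ r : QStar P C, r.stem = x ∧ (∀ i, r.t i = p.t (m + i)) ∧ τ.DecidedBy r

end Deciding

end Creatures

/-!
Fix an open dense set `E`, and say that `(x, t_0, t_1, …)` is essentially in `E` if for some `m`
all conditions `(y, t_m, t_{m+1}, …)` with `y ∈ pos(x, t_0, …, t_{m-1})` lie in `E`.  The Halving
Property gives a dichotomy.  Replace all `t_i` by `half(t_i)`.  Either no refinement of the halved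
sequence with positive norms is essentially in `E`, so that the halved sequence avoids `E`; or
there is one, and un-halving a finite part of it gives a refinement of the original sequence which
is essentially in `E` and has norms at least half of the original ones.  A fusion settles this
dichotomy at every `y ∈ pos(x, t_0, …, t_{i-1})`, for all `i`.  As `φ` at least doubles at each
step, the creature `t_i` is halved at most `∑_{j ≤ i} φ(m_dn(t_j)) ≤ 2 φ(m_dn(t_i))` times, and
fastness of `f` pays for this.

Bigness then makes each `t_i` homogeneous with respect to the settled alternatives, at a cost of
at most `φ(m_dn(t_i))`.  If the root avoided `E`, homogeneity would propagate avoidance to all `y`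
at all levels.  But density of `E` gives an extension in `E`, and some tail of it has positive
norms, so avoidance fails at the stem of that tail.

Hence each condition `p` has, for each `n`, an extension `q` with `p ≤^f_n q` which is essentially
in `E`.  A fusion along `≤^f_n` treats countably many such `E` at once.  For names this is the
first part of the theorem.  For the second part, take the upward closures of the dense sets in
`N`: when `q` is essentially in the upward closure of `A`, a finite subset of `A` is predense
above `q`.
-/

namespace Creatures

section Products

variable {α : Type u} {H : ℕ → Set α}

/-- The product `∏_{i < l} H(i)`, realised as a set of lists of length `l`. -/
def seqs (H : ℕ → Set α) (l : ℕ) : Set (List α) :=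
  {w | IsSeq H w ∧ w.length = l}

theorem ncard_seqs (l : ℕ) : (seqs H l).ncard = phi H l := rfl

theorem append_singleton_mem_seqs {l : ℕ} {w : List α} {a : α} :
    w ++ [a] ∈ seqs H (l + 1) ↔ w ∈ seqs H l ∧ a ∈ H l := by
  simp only [seqs, IsSeq, Set.mem_ofPred_eq, List.length_append, List.length_singleton,
    Nat.add_right_cancel_iff]
  constructor
  · rintro ⟨h, rfl⟩
    exact ⟨⟨fun i hi => by simpa only [List.getElem_append_left hi] using h i (by omega), rfl⟩,
      by simpa using h w.length (by omega)⟩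
  · rintro ⟨⟨h, rfl⟩, ha⟩
    refine ⟨fun i hi => ?_, rfl⟩
    rcases Nat.lt_succ_iff_lt_or_eq.1 hi with hi' | rfl
    · simpa only [List.getElem_append_left hi'] using h i hi'
    · simpa using ha

theorem seqs_zero : seqs H 0 = {[]} := by
  ext w
  simp +contextual [seqs, IsSeq]

theorem seqs_succ (l : ℕ) :
    seqs H (l + 1) = Set.image2 (fun w a => w ++ [a]) (seqs H l) (H l) := by
  ext w
  constructor
  · intro hw
    rcases List.eq_nil_or_concat' w with rfl | ⟨w, a, rfl⟩
    · simpa using hw.2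
    · have h := append_singleton_mem_seqs.1 hw
      exact ⟨w, h.1, a, h.2, rfl⟩
  · rintro ⟨w, hw, a, ha, rfl⟩
    exact append_singleton_mem_seqs.2 ⟨hw, ha⟩

theorem phi_succ (l : ℕ) : phi H (l + 1) = phi H l * (H l).ncard := by
  have hinj : Function.Injective fun x : List α × α => x.1 ++ [x.2] := by
    rintro ⟨w, a⟩ ⟨w', a'⟩ h
    simpa using h
  rw [← ncard_seqs, seqs_succ, ← Set.image_prod, Set.ncard_image_of_injective _ hinj,
    Set.ncard_prod, ncard_seqs]

theorem IsFinitarySeq.seqs_finite (h : IsFinitarySeq H) : ∀ l, (seqs H l).Finite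
  | 0 => by simp only [seqs_zero, Set.finite_singleton]
  | l + 1 => by
    rw [seqs_succ]
    exact (h.seqs_finite l).image2 _ (h l)

theorem IsFinitarySeq.two_mul_phi_le (h : IsFinitarySeq H) (hH : ∀ m, (H m).Nontrivial) (l : ℕ) :
    2 * phi H l ≤ phi H (l + 1) := by
  have : Finite (H l) := h l
  have htwo : 2 ≤ (H l).ncard := Set.one_lt_ncard_iff_nontrivial.2 (hH l)
  rw [phi_succ, mul_comm]
  gcongr

theorem IsFinitarySeq.phi_mono (h : IsFinitarySeq H) (hH : ∀ m, (H m).Nontrivial) :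
    Monotone (phi H) :=
  monotone_nat_of_le_succ fun l => by have := h.two_mul_phi_le hH l; omega

theorem sum_range_succ_le_two_mul {a : ℕ → ℕ} (h : ∀ n, 2 * a n ≤ a (n + 1)) (n : ℕ) :
    ∑ i ∈ Finset.range (n + 1), a i ≤ 2 * a n := by
  induction n with
  | zero =>
    rw [zero_add, Finset.sum_range_one]
    exact Nat.le_mul_of_pos_left _ two_pos
  | succ n ih =>
    rw [Finset.sum_range_succ]
    have := h n
    omega

theorem IsFinitarySeq.sum_phi_le (h : IsFinitarySeq H) (hH : ∀ m, (H m).Nontrivial) {l : ℕ → ℕ}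
    (hl : StrictMono l) (n : ℕ) :
    ∑ i ∈ Finset.range (n + 1), phi H (l i) ≤ 2 * phi H (l n) :=
  sum_range_succ_le_two_mul (a := fun i => phi H (l i))
    (fun i => (h.two_mul_phi_le hH _).trans (h.phi_mono hH (hl (Nat.lt_succ_self i)))) n

end Products

section Subsequences

variable {X : Type*} {t s : ℕ → X}

/-- The sequence `t_m, t_{m+1}, …`. -/
def shift (t : ℕ → X) (m : ℕ) : ℕ → X := fun i => t (m + i)

@[simp] theorem shift_apply (t : ℕ → X) (m i : ℕ) : shift t m i = t (m + i) := rfl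

@[simp] theorem shift_zero (t : ℕ → X) : shift t 0 = t := funext fun i => by simp

theorem shift_shift (t : ℕ → X) (m n : ℕ) : shift (shift t m) n = shift t (m + n) :=
  funext fun i => by simp [add_assoc]

/-- The sequence `t_0, …, t_{m-1}, s_0, s_1, …`. -/
def splice (m : ℕ) (t s : ℕ → X) : ℕ → X := fun i => if i < m then t i else s (i - m)

theorem splice_of_lt {m i : ℕ} (h : i < m) : splice m t s i = t i := if_pos h

theorem splice_of_le {m i : ℕ} (h : m ≤ i) : splice m t s i = s (i - m) := if_neg (by omega)

@[simp] theorem splice_add (m i : ℕ) : splice m t s (m + i) = s i := by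
  rw [splice_of_le (Nat.le_add_right m i), Nat.add_sub_cancel_left]

@[simp] theorem shift_splice (m : ℕ) : shift (splice m t s) m = s :=
  funext fun i => splice_add m i

end Subsequences

section Segments

variable {α : Type u} {H : ℕ → Set α} {D : Type v} {t s : ℕ → WeakCreature H D}

theorem seg_self (t : ℕ → WeakCreature H D) (a : ℕ) : seg t a a = ∅ := by simp [seg]

theorem seg_succ (t : ℕ → WeakCreature H D) (a : ℕ) : seg t a (a + 1) = {t a} := by
  rw [seg, Set.Ico_add_one_right_eq_Icc, Set.Icc_self, Set.image_singleton]

theorem seg_union (t : ℕ → WeakCreature H D) {a b c : ℕ} (hab : a ≤ b) (hbc : b ≤ c) :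
    seg t a b ∪ seg t b c = seg t a c := by
  rw [seg, seg, seg, ← Set.image_union, Set.Ico_union_Ico_eq_Ico hab hbc]

theorem seg_shift (t : ℕ → WeakCreature H D) (m a b : ℕ) :
    seg (shift t m) a b = seg t (m + a) (m + b) := by
  rw [seg, seg, ← Set.image_const_add_Ico, Set.image_image]
  rfl

theorem seg_shift_zero (t : ℕ → WeakCreature H D) (m n : ℕ) :
    seg (shift t m) 0 n = seg t m (m + n) :=
  seg_shift t m 0 n

theorem seg_congr {a b : ℕ} (h : ∀ i, a ≤ i → i < b → t i = s i) : seg t a b = seg s a b :=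
  Set.image_congr fun i hi => h i hi.1 hi.2

theorem seg_splice {m n a : ℕ} (h : n ≤ m) : seg (splice m t s) a n = seg t a n :=
  seg_congr fun _ _ hi => splice_of_lt (by omega)

theorem seg_countable (t : ℕ → WeakCreature H D) (a b : ℕ) : (seg t a b).Countable :=
  (Set.to_countable _).image _

end Segments

section Possibilities

variable {α : Type u} {H : ℕ → Set α} {D : Type v} {P : CreatingPair H D}

theorem posStar_empty (x : List α) : posStar P.Sg x ∅ = ∅ := by
  simp [posStar, P.Sg_empty]

theorem pos_empty (x : List α) : pos P.Sg x ∅ = {x} := by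
  refine Set.eq_singleton_iff_unique_mem.2 ⟨IsPos.nil x, fun u h => ?_⟩
  change IsPos P.Sg x ∅ u at h
  generalize hE : (∅ : Set (WeakCreature H D)) = S at h
  cases h with
  | nil => rfl
  | cons hz =>
    rw [(Set.union_empty_iff.1 hE.symm).1, posStar_empty] at hz
    exact hz.elim

theorem pos_singleton (x : List α) (c : WeakCreature H D) :
    pos P.Sg x {c} = posStar P.Sg x {c} := by
  ext u
  constructor
  · intro h
    change IsPos P.Sg x {c} u at h
    generalize hE : ({c} : Set (WeakCreature H D)) = B at h
    cases h with
    | nil => exact absurd hE (Set.singleton_ne_empty c)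
    | @cons _ y _ A S hy hd hu =>
      rcases Set.subset_singleton_iff_eq.1 (Set.subset_union_left.trans hE.ge) with rfl | rfl
      · rw [posStar_empty] at hy
        exact hy.elim
      obtain rfl : S = ∅ := hd.eq_bot_of_ge (Set.subset_union_right.trans hE.ge)
      obtain rfl : u = y := by rwa [← Set.mem_singleton_iff, ← pos_empty (P := P)]
      rwa [Set.union_empty]
  · intro h
    rw [← Set.union_empty {c}]
    exact IsPos.cons h (Set.disjoint_empty _) (IsPos.nil u)

theorem pos_singleton_nonempty {x : List α} {c : WeakCreature H D} (h : x ∈ basis P.Sg c) :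
    (pos P.Sg x {c}).Nonempty := by
  obtain ⟨s, hs, u, hu⟩ := h
  rw [pos_singleton]
  exact ⟨u, s, hs, hu⟩

theorem CreatingPair.Sg_singleton_subset {c d : WeakCreature H D} (hc : c ∈ P.K)
    (hd : d ∈ P.Sg {c}) : P.Sg {d} ⊆ P.Sg {c} := by
  have hdK : d ∈ P.K :=
    P.Sg_subset _ (Set.singleton_subset_iff.2 hc) (Set.countable_singleton c) hd
  have hsub := P.Sg_trans {d} (Set.singleton_subset_iff.2 hdK) (Set.countable_singleton d)
    (fun _ => {c})
    (by rintro _ rfl; exact ⟨Set.singleton_subset_iff.2 hc, Set.countable_singleton c, hd⟩)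
  rwa [Set.biUnion_singleton] at hsub

theorem CreatingPair.basis_subset_of_mem_Sg_singleton {c d : WeakCreature H D} (hc : c ∈ P.K)
    (hd : d ∈ P.Sg {c}) : basis P.Sg c ⊆ basis P.Sg d :=
  P.nice 0 (fun _ => c) ⟨fun _ _ => hc, fun i hi => by omega⟩ d (by rwa [seg_succ])

theorem pos_singleton_subset_of_mem_Sg {c d : WeakCreature H D} (hc : c ∈ P.K)
    (hd : d ∈ P.Sg {c}) (u : List α) : pos P.Sg u {d} ⊆ pos P.Sg u {c} := by
  rw [pos_singleton, pos_singleton]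
  rintro y ⟨s, hs, hy⟩
  exact ⟨s, P.Sg_singleton_subset hc hd hs, hy⟩

end Possibilities

section Chains

variable {α : Type u} {H : ℕ → Set α} {D : Type v} {P : CreatingPair H D}
  {t : ℕ → WeakCreature H D} {x y u : List α} {a b c : ℕ}

theorem CreatingPair.basis_subset_seqs {c : WeakCreature H D} (hc : c ∈ P.K) :
    basis P.Sg c ⊆ seqs H c.mdn := by
  rintro x ⟨s, hs, u, hu⟩
  have hlinked : IsLinked P.K (fun _ => c) 1 := ⟨fun _ _ => hc, fun i hi => by omega⟩
  have hs' : s ∈ P.Sg (seg (fun _ => c) 0 1) := by rwa [seg_succ]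
  have hsK : s ∈ P.K := P.Sg_subset {c} (by simpa using hc) (Set.countable_singleton c) hs
  exact ⟨(s.val_spec _ hu).1,
    (P.creature s hsK _ hu).1.trans (P.Sg_ends 0 _ hlinked s hs').1⟩

/-- An infinite sequence of creatures every initial segment of which is linked. -/
structure IsChain (P : CreatingPair H D) (t : ℕ → WeakCreature H D) : Prop where
  mem : ∀ i, t i ∈ P.K
  link : ∀ i, (t i).mup = (t (i + 1)).mdn

namespace IsChain

theorem strictMono (h : IsChain P t) : StrictMono fun i => (t i).mdn :=
  strictMono_nat_of_lt_succ fun i => by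
    rw [← h.link i]
    exact (P.creature _ (h.mem i)).mdn_lt_mup

theorem mdn_inj (h : IsChain P t) {i j : ℕ} (hij : (t i).mdn = (t j).mdn) : i = j :=
  h.strictMono.injective hij

theorem injective (h : IsChain P t) : Function.Injective t := fun _ _ hij =>
  h.mdn_inj (congrArg WeakCreature.mdn hij)

theorem shift (h : IsChain P t) (m : ℕ) : IsChain P (shift t m) :=
  ⟨fun _ => h.mem _, fun _ => h.link _⟩

theorem isLinked (h : IsChain P t) (n : ℕ) : IsLinked P.K t n :=
  ⟨fun i _ => h.mem i, fun i _ => h.link i⟩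

theorem seg_subset (h : IsChain P t) (a b : ℕ) : seg t a b ⊆ P.K := by
  rintro _ ⟨i, _, rfl⟩
  exact h.mem i

theorem disjoint_seg (h : IsChain P t) {d : ℕ} (hbc : b ≤ c) :
    Disjoint (seg t a b) (seg t c d) :=
  (Set.disjoint_image_iff h.injective).2 (Set.disjoint_left.2 fun _ hx hx' =>
    absurd (hx.2.trans_le hbc) (not_lt.2 hx'.1))

theorem Sg_seg_subset (h : IsChain P t) : P.Sg (seg t a b) ⊆ P.K :=
  P.Sg_subset _ (h.seg_subset a b) (seg_countable t a b)

theorem mdn_mup_of_mem_Sg (h : IsChain P t) (hab : a < b) {d : WeakCreature H D}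
    (hd : d ∈ P.Sg (seg t a b)) : d.mdn = (t a).mdn ∧ d.mup = (t b).mdn := by
  obtain ⟨n, rfl⟩ := Nat.exists_eq_add_of_lt hab
  rw [add_assoc, ← seg_shift_zero] at hd
  obtain ⟨hdn, hup⟩ := P.Sg_ends n _ ((h.shift a).isLinked _) d hd
  exact ⟨hdn, hup.trans (h.link _)⟩

theorem basis_subset_of_mem_Sg (h : IsChain P t) (hab : a < b) {d : WeakCreature H D}
    (hd : d ∈ P.Sg (seg t a b)) : basis P.Sg (t a) ⊆ basis P.Sg d := by
  obtain ⟨n, rfl⟩ := Nat.exists_eq_add_of_lt hab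
  rw [add_assoc, ← seg_shift_zero] at hd
  exact P.nice n _ ((h.shift a).isLinked _) d hd

theorem eq_seg_of_Sg_nonempty (h : IsChain P t) {A : Set (WeakCreature H D)}
    (hA : A ⊆ Set.range t) (hne : (P.Sg A).Nonempty) : ∃ a b, a < b ∧ A = seg t a b := by
  obtain ⟨n, t', rfl, hl⟩ := P.Sg_linked A (hA.trans (by rintro _ ⟨i, rfl⟩; exact h.mem i))
    ((Set.countable_range t).mono hA) hne
  rcases Nat.eq_zero_or_pos n with rfl | hn
  · rw [seg_self, P.Sg_empty] at hne
    exact absurd hne Set.not_nonempty_empty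
  obtain ⟨a, ha⟩ := hA ⟨0, ⟨le_rfl, hn⟩, rfl⟩
  have heq : ∀ i < n, t (a + i) = t' i := by
    intro i
    induction i with
    | zero => exact fun _ => ha
    | succ i ih =>
      intro hi
      obtain ⟨j, hj⟩ := hA ⟨i + 1, ⟨by omega, hi⟩, rfl⟩
      have hlink := hl.2 i hi
      rw [← hj, ← ih (by omega), h.link] at hlink
      rw [← hj, ← h.mdn_inj hlink]
      rfl
  refine ⟨a, a + n, by omega, ?_⟩
  rw [← seg_shift_zero]
  exact seg_congr fun i _ hi => (heq i hi).symm

theorem exists_eq_seg_of_isPos (h : IsChain P t) {S : Set (WeakCreature H D)}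
    (hu : IsPos P.Sg x S u) (hS : S ⊆ Set.range t) (hx : x.length = (t a).mdn) :
    ∃ b, a ≤ b ∧ S = seg t a b ∧ u.length = (t b).mdn := by
  induction hu generalizing a with
  | nil x => exact ⟨a, le_rfl, (seg_self t a).symm, hx⟩
  | @cons x y u A S hy _ _ ih =>
    obtain ⟨d, hd, hxy⟩ := hy
    obtain ⟨a', c, hac, rfl⟩ := h.eq_seg_of_Sg_nonempty (Set.subset_union_left.trans hS) ⟨d, hd⟩
    obtain ⟨hdn, hup⟩ := h.mdn_mup_of_mem_Sg hac hd
    obtain ⟨hlx, hly⟩ := P.creature d (h.Sg_seg_subset hd) _ hxy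
    obtain rfl : a = a' := h.mdn_inj (hx.symm.trans (hlx.trans hdn))
    obtain ⟨b, hcb, rfl, hu⟩ := ih (Set.subset_union_right.trans hS) (hly.trans hup)
    exact ⟨b, hac.le.trans hcb, seg_union t hac.le hcb, hu⟩

theorem length_of_mem_pos (h : IsChain P t) (hab : a ≤ b) (hx : x.length = (t a).mdn)
    (hu : u ∈ pos P.Sg x (seg t a b)) : u.length = (t b).mdn := by
  obtain ⟨c, hac, hS, hl⟩ := h.exists_eq_seg_of_isPos hu (Set.image_subset_range _ _) hx
  have hIco : Set.Ico a b = Set.Ico a c := h.injective.image_injective hS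
  have hcb : c = b := by
    have hb := Set.ext_iff.1 hIco b
    have hc := Set.ext_iff.1 hIco c
    simp only [Set.mem_Ico] at hb hc
    omega
  rw [hl, hcb]

theorem pos_trans (h : IsChain P t) (hab : a ≤ b) (hbc : b ≤ c)
    (hy : y ∈ pos P.Sg x (seg t a b)) (hu : u ∈ pos P.Sg y (seg t b c)) :
    u ∈ pos P.Sg x (seg t a c) := by
  rw [← seg_union t hab hbc]
  exact IsPos.trans hy hu (h.disjoint_seg le_rfl)

end IsChain

end Chains

section Refinements

variable {α : Type u} {H : ℕ → Set α} {D : Type v} {P : CreatingPair H D}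
  {t s r : ℕ → WeakCreature H D} {b c : ℕ → ℕ}

/-- Each creature `s_i` is composed from the creatures `t_{b(i)}, …, t_{b(i+1)-1}`. -/
structure ComposedAlong (P : CreatingPair H D) (b : ℕ → ℕ) (t s : ℕ → WeakCreature H D) :
    Prop where
  strictMono : StrictMono b
  mem : ∀ i, s i ∈ P.Sg (seg t (b i) (b (i + 1)))

/-- `s` arises from `t` by cutting `t` into consecutive finite intervals and composing a creature
from each of them; this is the order on conditions with a fixed stem. -/
def Refines (P : CreatingPair H D) (t s : ℕ → WeakCreature H D) : Prop :=
  ∃ b : ℕ → ℕ, b 0 = 0 ∧ ComposedAlong P b t s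

theorem IsChain.exists_composedAlong (ht : IsChain P t) (hs : IsChain P s)
    (h : ∀ i, ∃ a b, a < b ∧ s i ∈ P.Sg (seg t a b)) : ∃ b, ComposedAlong P b t s := by
  choose a b hab hm using h
  have hba : ∀ i, b i = a (i + 1) := fun i => ht.mdn_inj <| by
    rw [← (ht.mdn_mup_of_mem_Sg (hab i) (hm i)).2, hs.link,
      (ht.mdn_mup_of_mem_Sg (hab (i + 1)) (hm (i + 1))).1]
  exact ⟨a, strictMono_nat_of_lt_succ fun i => hba i ▸ hab i, fun i => hba i ▸ hm i⟩

namespace ComposedAlong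

theorem of_forall_mem_Sg_singleton (h : ∀ i, s i ∈ P.Sg {t i}) : ComposedAlong P id t s :=
  ⟨strictMono_id, fun i => by simpa only [id, seg_succ] using h i⟩

theorem refl (ht : IsChain P t) : ComposedAlong P id t t :=
  of_forall_mem_Sg_singleton fun i => P.Sg_self _ (ht.mem i)

theorem mdn_eq (h : ComposedAlong P b t s) (ht : IsChain P t) (i : ℕ) :
    (s i).mdn = (t (b i)).mdn :=
  (ht.mdn_mup_of_mem_Sg (h.strictMono i.lt_succ_self) (h.mem i)).1

theorem isChain (h : ComposedAlong P b t s) (ht : IsChain P t) : IsChain P s :=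
  ⟨fun i => ht.Sg_seg_subset (h.mem i), fun i => by
    rw [(ht.mdn_mup_of_mem_Sg (h.strictMono i.lt_succ_self) (h.mem i)).2, h.mdn_eq ht]⟩

theorem exists_cover (h : ComposedAlong P b t s) (ht : IsChain P t) :
    ∃ T : WeakCreature H D → Set (WeakCreature H D),
      (∀ i, T (s i) = seg t (b i) (b (i + 1))) ∧
      ∀ i j, i ≤ j → (⋃ x ∈ seg s i j, T x) = seg t (b i) (b j) := by
  have hT := (h.isChain ht).injective.extend_apply (fun i => seg t (b i) (b (i + 1))) fun _ => ∅
  refine ⟨_, hT, fun i j hij => ?_⟩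
  induction j, hij using Nat.le_induction with
  | base => simp only [seg_self, Set.mem_empty_iff_false, Set.iUnion_of_empty, Set.iUnion_empty]
  | succ j hij ih =>
    rw [← seg_union s hij j.le_succ, Set.biUnion_union, ih, seg_succ, Set.biUnion_singleton, hT,
      seg_union t (h.strictMono.monotone hij) (h.strictMono.monotone j.le_succ)]

theorem pos_subset (h : ComposedAlong P b t s) (ht : IsChain P t) (x : List α) {i j : ℕ}
    (hij : i ≤ j) : pos P.Sg x (seg s i j) ⊆ pos P.Sg x (seg t (b i) (b j)) := by
  obtain ⟨T, hT, hU⟩ := h.exists_cover ht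
  intro u hu
  rw [← hU i j hij]
  refine IsPos.coarsen P hu T ((h.isChain ht).seg_subset _ _) (seg_countable _ _ _) ?_ ?_
  · rintro _ ⟨k, _, rfl⟩
    rw [hT]
    exact ⟨ht.seg_subset _ _, seg_countable _ _ _, h.mem k⟩
  · rintro _ ⟨k, _, rfl⟩ _ ⟨l, _, rfl⟩ hkl
    rw [hT, hT]
    rcases lt_or_gt_of_ne (fun h : k = l => hkl (h ▸ rfl)) with hlt | hlt
    · exact ht.disjoint_seg (h.strictMono.monotone hlt)
    · exact (ht.disjoint_seg (h.strictMono.monotone hlt)).symm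

theorem Sg_subset (h : ComposedAlong P b t s) (ht : IsChain P t) {i j : ℕ} (hij : i ≤ j) :
    P.Sg (seg s i j) ⊆ P.Sg (seg t (b i) (b j)) := by
  obtain ⟨T, hT, hU⟩ := h.exists_cover ht
  rw [← hU i j hij]
  refine P.Sg_trans _ ((h.isChain ht).seg_subset _ _) (seg_countable _ _ _) T ?_
  rintro _ ⟨k, _, rfl⟩
  rw [hT]
  exact ⟨ht.seg_subset _ _, seg_countable _ _ _, h.mem k⟩

theorem trans (h : ComposedAlong P b t s) (ht : IsChain P t) (h' : ComposedAlong P c s r) :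
    ComposedAlong P (b ∘ c) t r :=
  ⟨h.strictMono.comp h'.strictMono, fun i =>
    h.Sg_subset ht (h'.strictMono.monotone i.le_succ) (h'.mem i)⟩

theorem shift (h : ComposedAlong P b t s) {k m : ℕ} (hk : k ≤ b m) :
    ComposedAlong P (fun i => b (m + i) - k) (shift t k) (shift s m) := by
  have hb : ∀ i, k ≤ b (m + i) := fun i => hk.trans (h.strictMono.monotone (by omega))
  refine ⟨strictMono_nat_of_lt_succ fun i =>
    Nat.sub_lt_sub_right (hb i) (h.strictMono (by omega)), fun i => ?_⟩
  rw [seg_shift, Nat.add_sub_cancel' (hb i), Nat.add_sub_cancel' (hb (i + 1))]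
  exact h.mem (m + i)

theorem of_shift {k : ℕ} (h : ComposedAlong P b (Creatures.shift t k) s) :
    ComposedAlong P (fun i => k + b i) t s :=
  ⟨fun _ _ hij => Nat.add_lt_add_left (h.strictMono hij) k, fun i => by
    rw [← seg_shift]
    exact h.mem i⟩

end ComposedAlong

namespace Refines

theorem of_forall_mem_Sg_singleton (h : ∀ i, s i ∈ P.Sg {t i}) : Refines P t s :=
  ⟨id, rfl, .of_forall_mem_Sg_singleton h⟩

theorem refl (ht : IsChain P t) : Refines P t t := ⟨id, rfl, .refl ht⟩

theorem trans (h : Refines P t s) (ht : IsChain P t) (h' : Refines P s r) : Refines P t r := by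
  obtain ⟨b, hb0, hb⟩ := h
  obtain ⟨c, hc0, hc⟩ := h'
  exact ⟨b ∘ c, by simp only [Function.comp_apply, hc0, hb0], hb.trans ht hc⟩

theorem isChain (h : Refines P t s) (ht : IsChain P t) : IsChain P s :=
  let ⟨_, _, hb⟩ := h
  hb.isChain ht

theorem mdn_zero (h : Refines P t s) (ht : IsChain P t) : (s 0).mdn = (t 0).mdn := by
  obtain ⟨b, hb0, hb⟩ := h
  rw [hb.mdn_eq ht, hb0]

theorem shift (h : Refines P t s) (ht : IsChain P t) {m n : ℕ} (hmn : (s m).mdn = (t n).mdn) :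
    Refines P (shift t n) (shift s m) := by
  obtain ⟨b, _, hb⟩ := h
  have hbm : b m = n := ht.mdn_inj (by rw [← hb.mdn_eq ht, hmn])
  exact ⟨_, by simp [hbm], hb.shift hbm.ge⟩

end Refines

theorem ComposedAlong.refines (h : ComposedAlong P b t s) (ht : IsChain P t)
    (hmdn : (s 0).mdn = (t 0).mdn) : Refines P t s :=
  ⟨b, ht.mdn_inj (by rw [← h.mdn_eq ht, hmdn]), h⟩

theorem IsChain.refines_splice (ht : IsChain P t) {m : ℕ}
    (h : Refines P (Creatures.shift t m) s) : Refines P t (splice m t s) := by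
  obtain ⟨b, hb0, hb⟩ := h
  set c := splice m id fun i => m + b i
  have hcm : ∀ i, c (m + i) = m + b i := splice_add m
  have hc : ∀ i ≤ m, c i = i := fun i hi => by
    rcases hi.eq_or_lt with rfl | hi
    · simpa only [hb0, add_zero] using hcm 0
    · exact splice_of_lt hi
  refine ⟨c, hc 0 m.zero_le, strictMono_nat_of_lt_succ fun i => ?_, fun i => ?_⟩ <;>
    rcases lt_or_ge i m with hi | hi
  · rw [hc i hi.le, hc (i + 1) hi]
    exact i.lt_succ_self
  · obtain ⟨i, rfl⟩ := Nat.exists_eq_add_of_le hi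
    rw [add_assoc, hcm, hcm]
    exact Nat.add_lt_add_left (hb.strictMono i.lt_succ_self) m
  · rw [hc i hi.le, hc (i + 1) hi, seg_succ, splice_of_lt hi]
    exact P.Sg_self _ (ht.mem i)
  · obtain ⟨i, rfl⟩ := Nat.exists_eq_add_of_le hi
    rw [add_assoc, hcm, hcm, splice_add, ← seg_shift]
    exact hb.mem i

theorem Refines.of_eventuallyEq {X : ℕ → ℕ → WeakCreature H D} (hX : ∀ n, IsChain P (X n))
    (h : ∀ n, Refines P (X n) (X (n + 1))) (hs : ∀ i, ∀ᶠ n in Filter.atTop, X n i = s i) (n : ℕ) :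
    Refines P (X n) s := by
  have hR : ∀ m, n ≤ m → Refines P (X n) (X m) := fun m hm => by
    induction m, hm using Nat.le_induction with
    | base => exact .refl (hX n)
    | succ m _ ih => exact ih.trans (hX n) (h m)
  have hev : ∀ i, ∃ m, X m i = s i ∧ n ≤ m := fun i =>
    ((hs i).and (Filter.eventually_ge_atTop n)).exists
  have hchain : IsChain P s := by
    refine ⟨fun i => ?_, fun i => ?_⟩
    · obtain ⟨m, hm, _⟩ := hev i
      exact hm ▸ (hX m).mem i
    · obtain ⟨m, hm, hm'⟩ := ((hs i).and (hs (i + 1))).exists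
      exact hm ▸ hm' ▸ (hX m).link i
  obtain ⟨b, hb⟩ := (hX n).exists_composedAlong hchain fun i => by
    obtain ⟨m, hm, hnm⟩ := hev i
    obtain ⟨b, _, hb⟩ := hR m hnm
    exact ⟨b i, b (i + 1), hb.strictMono i.lt_succ_self, hm ▸ hb.mem i⟩
  obtain ⟨m, hm, hnm⟩ := hev 0
  exact hb.refines (hX n) (hm ▸ (hR m hnm).mdn_zero (hX n))

end Refinements

section Candidates

variable {α : Type u} {H : ℕ → Set α} {D : Type v} {P : CreatingPair H D}
  {t s r : ℕ → WeakCreature H D} {x y u : List α}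

/-- All the sequences `(x, t_0, …, t_n)` are finite candidates. -/
structure IsCandidate (P : CreatingPair H D) (x : List α) (t : ℕ → WeakCreature H D) : Prop
    extends isChain : IsChain P t where
  pos_subset_basis : ∀ n, pos P.Sg x (seg t 0 n) ⊆ basis P.Sg (t n)

namespace IsCandidate

theorem mem_pos_zero (x : List α) : x ∈ pos P.Sg x (seg t 0 0) := by
  rw [seg_self]
  exact IsPos.nil x

theorem mem_basis (h : IsCandidate P x t) : x ∈ basis P.Sg (t 0) :=
  h.pos_subset_basis 0 (mem_pos_zero x)

theorem mem_seqs (h : IsCandidate P x t) : x ∈ seqs H (t 0).mdn :=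
  CreatingPair.basis_subset_seqs (h.mem 0) h.mem_basis

theorem pos_subset_seqs (h : IsCandidate P x t) (n : ℕ) :
    pos P.Sg x (seg t 0 n) ⊆ seqs H (t n).mdn := fun _ hu =>
  CreatingPair.basis_subset_seqs (h.mem n) (h.pos_subset_basis n hu)

theorem shift (h : IsCandidate P x t) {m : ℕ} (hy : y ∈ pos P.Sg x (seg t 0 m)) :
    IsCandidate P y (shift t m) :=
  ⟨h.isChain.shift m, fun n u hu => by
    rw [seg_shift_zero] at hu
    exact h.pos_subset_basis (m + n) (h.pos_trans m.zero_le (m.le_add_right n) hy hu)⟩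

theorem take_mem_pos (h : IsCandidate P x t) {m n : ℕ} (hmn : m ≤ n)
    (hu : u ∈ pos P.Sg x (seg t 0 n)) :
    u.take (t m).mdn ∈ pos P.Sg x (seg t 0 m) ∧
      u ∈ pos P.Sg (u.take (t m).mdn) (seg t m n) := by
  rcases hmn.eq_or_lt with rfl | hmn
  · rw [List.take_of_length_le (h.pos_subset_seqs m hu).2.le, seg_self]
    exact ⟨hu, IsPos.nil u⟩
  · exact P.smooth x n t ⟨by omega, h.isLinked n, h.mem_basis, fun i _ => h.pos_subset_basis _⟩
      m hmn u hu

theorem pos_nonempty (h : IsCandidate P x t) (n : ℕ) : (pos P.Sg x (seg t 0 n)).Nonempty := by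
  induction n with
  | zero => exact ⟨x, mem_pos_zero x⟩
  | succ n ih =>
    obtain ⟨y, hy⟩ := ih
    obtain ⟨u, hu⟩ := pos_singleton_nonempty (h.pos_subset_basis n hy)
    rw [← seg_succ t n] at hu
    exact ⟨u, h.pos_trans n.zero_le n.le_succ hy hu⟩

theorem of_refines (h : IsCandidate P x t) (hs : Refines P t s) : IsCandidate P x s := by
  refine ⟨hs.isChain h.isChain, fun n u hu => ?_⟩
  obtain ⟨b, hb0, hb⟩ := hs
  have hut := hb.pos_subset h.isChain x n.zero_le hu
  rw [hb0] at hut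
  exact h.basis_subset_of_mem_Sg (hb.strictMono n.lt_succ_self) (hb.mem n)
    (h.pos_subset_basis _ hut)

theorem pos_subset_pos (h : IsCandidate P x t) (hs : IsChain P s) {m : ℕ}
    (hts : ∀ n < m, ∀ u ∈ pos P.Sg x (seg t 0 n), pos P.Sg u {t n} ⊆ pos P.Sg u {s n}) :
    pos P.Sg x (seg t 0 m) ⊆ pos P.Sg x (seg s 0 m) := by
  induction m with
  | zero => rw [seg_self, seg_self]
  | succ m ih =>
    intro y hy
    obtain ⟨hpre, hlast⟩ := h.take_mem_pos m.le_succ hy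
    rw [seg_succ] at hlast
    refine hs.pos_trans m.zero_le m.le_succ (ih (fun n hn => hts n (by omega)) hpre) ?_
    rw [seg_succ]
    exact hts m m.lt_succ_self _ hpre hlast

end IsCandidate

end Candidates

section Conditions

variable {α : Type u} {H : ℕ → Set α} {D : Type v} {P : CreatingPair H D}

namespace QStar

variable {C : (ℕ → WeakCreature H D) → Prop} {p q : QStar P C}

theorem isChain (p : QStar P C) : IsChain P p.t := ⟨p.t_mem, p.link⟩

theorem stem_mem_seqs (p : QStar P C) : p.stem ∈ seqs H (p.t 0).mdn :=
  CreatingPair.basis_subset_seqs (p.t_mem 0) p.stem_mem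

theorem isCandidate (p : QStar P C) : IsCandidate P p.stem p.t :=
  ⟨p.isChain, fun n u hu => by
    obtain ⟨i, _, hi⟩ := p.pos_mem _ u hu
    have hn := p.isChain.length_of_mem_pos n.zero_le p.stem_mem_seqs.2 hu
    have hil := (CreatingPair.basis_subset_seqs (p.t_mem i) hi).2
    rwa [p.isChain.mdn_inj (hn.symm.trans hil)]⟩

/-- The condition `(x, t_0, t_1, …)`. -/
def ofCandidate {x : List α} {t : ℕ → WeakCreature H D} (h : IsCandidate P x t) (hC : C t) :
    QStar P C where
  stem := x
  t := t
  t_mem := h.mem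
  stem_mem := h.mem_basis
  link := h.link
  norm_cond := hC
  pos_mem := fun I u hu => by
    obtain ⟨b, _, hI, _⟩ :=
      h.exists_eq_seg_of_isPos (a := 0) hu (Set.image_subset_range _ _) h.mem_seqs.2
    obtain rfl : I = Set.Ico 0 b := h.injective.image_injective hI
    exact ⟨b, by simp, h.pos_subset_basis b hu⟩

theorem le_of_composedAlong {b : ℕ → ℕ} (hb : ComposedAlong P b p.t q.t)
    (h : q.stem ∈ pos P.Sg p.stem (seg p.t 0 (b 0))) : p ≤ q :=
  ⟨Set.Ico 0 (b 0), fun i => Set.Ico (b i) (b (i + 1)),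
    fun i => Set.disjoint_left.2 fun _ hx hx' =>
      absurd (hx.2.trans_le (hb.strictMono.monotone i.zero_le)) (not_lt.2 hx'.1),
    fun _ _ hij => hb.strictMono.monotone.pairwise_disjoint_on_Ico_succ hij, h, hb.mem⟩

theorem exists_composedAlong_of_le (h : p ≤ q) :
    ∃ b, ComposedAlong P b p.t q.t ∧ q.stem ∈ pos P.Sg p.stem (seg p.t 0 (b 0)) := by
  obtain ⟨S₀, S, _, _, hst, hS⟩ := h
  obtain ⟨b, hb⟩ := p.isChain.exists_composedAlong q.isChain fun i => by
    obtain ⟨a, b, hab, he⟩ := p.isChain.eq_seg_of_Sg_nonempty (Set.image_subset_range _ _)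
      ⟨_, hS i⟩
    exact ⟨a, b, hab, he ▸ hS i⟩
  obtain ⟨c, _, hc, hl⟩ := p.isChain.exists_eq_seg_of_isPos (a := 0) hst
    (Set.image_subset_range _ _) p.stem_mem_seqs.2
  obtain rfl : c = b 0 := p.isChain.mdn_inj (by
    rw [← hl, q.stem_mem_seqs.2, hb.mdn_eq p.isChain])
  exact ⟨b, hb, hc ▸ hst⟩

theorem le_of_refines (h : Refines P p.t q.t) (hst : p.stem = q.stem) : p ≤ q := by
  obtain ⟨b, hb0, hb⟩ := h
  refine le_of_composedAlong hb ?_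
  rw [hb0, hst]
  exact IsCandidate.mem_pos_zero _

theorem refines_of_le (h : p ≤ q) (hst : p.stem = q.stem) : Refines P p.t q.t := by
  obtain ⟨b, hb, _⟩ := exists_composedAlong_of_le h
  refine hb.refines p.isChain ?_
  rw [← q.stem_mem_seqs.2, ← p.stem_mem_seqs.2, hst]

end QStar

end Conditions

section EssentialMembership

variable {α : Type u} {H : ℕ → Set α} {D : Type v} {P : CreatingPair H D} {f : ℕ → ℕ → ℕ}
  {t s : ℕ → WeakCreature H D} {E : Set (QF P f)} {x : List α}

theorem NormCond.shift (h : NormCond H D f t) (m : ℕ) : NormCond H D f (shift t m) := fun k => by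
  simpa only [shift_apply, add_comm m] using (Filter.tendsto_add_atTop_nat m).eventually (h k)

theorem NormCond.splice (h : NormCond H D f s) (m : ℕ) : NormCond H D f (splice m t s) :=
  fun k => by
    filter_upwards [(Filter.tendsto_sub_atTop_nat m).eventually (h k),
      Filter.eventually_ge_atTop m] with i hi hmi
    rwa [splice_of_le hmi]

/-- All the conditions `(y, t_m, t_{m+1}, …)` with `y ∈ pos(x, t_0, …, t_{m-1})` are in `E`. -/
def EssentiallyInAt (E : Set (QF P f)) (m : ℕ) (x : List α) (t : ℕ → WeakCreature H D) : Prop :=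
  ∀ y ∈ pos P.Sg x (seg t 0 m), ∃ r ∈ E, r.stem = y ∧ r.t = shift t m

/-- The condition `(x, t_0, t_1, …)` is essentially in `E`.  If `E` is the set of conditions
deciding a name, this says that the condition essentially decides the name. -/
def EssentiallyIn (E : Set (QF P f)) (x : List α) (t : ℕ → WeakCreature H D) : Prop :=
  ∃ m, EssentiallyInAt E m x t

/-- No extension of `(x, t_0, t_1, …)` with the same stem and positive norms is essentially
in `E`. -/
def Avoids (E : Set (QF P f)) (x : List α) (t : ℕ → WeakCreature H D) : Prop :=
  ∀ s, Refines P t s → (∀ i, 0 < (s i).nor) → NormCond H D f s → ¬ EssentiallyIn E x s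

/-- Either `(x, t_0, t_1, …)` is essentially in `E`, or no extension of it with the same stem and
positive norms is. -/
def IsSettled (E : Set (QF P f)) (x : List α) (t : ℕ → WeakCreature H D) : Prop :=
  EssentiallyIn E x t ∨ Avoids E x t

theorem EssentiallyInAt.of_composedAlong (hE : IsUpperSet E) (ht : IsCandidate P x t) {b : ℕ → ℕ}
    (hb : ComposedAlong P b t s) (hb0 : b 0 = 0) (hs : NormCond H D f s) {m n : ℕ} (hm : m ≤ b n)
    (h : EssentiallyInAt E m x t) : EssentiallyInAt E n x s := by
  intro y hy
  have hyt := hb.pos_subset ht.isChain x n.zero_le hy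
  rw [hb0] at hyt
  obtain ⟨hpre, hpost⟩ := ht.take_mem_pos hm hyt
  obtain ⟨r, hr, hrx, hrt⟩ := h _ hpre
  refine ⟨.ofCandidate ((ht.of_refines ⟨b, hb0, hb⟩).shift hy) (hs.shift n), hE ?_ hr, rfl, rfl⟩
  refine QStar.le_of_composedAlong (b := fun i => b (n + i) - m) (hrt ▸ hb.shift hm) ?_
  rwa [hrx, hrt, seg_shift_zero, add_zero, Nat.add_sub_cancel' hm]

theorem EssentiallyInAt.mono (hE : IsUpperSet E) (ht : IsCandidate P x t)
    (hN : NormCond H D f t) {m n : ℕ} (hm : m ≤ n) (h : EssentiallyInAt E m x t) :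
    EssentiallyInAt E n x t :=
  h.of_composedAlong hE ht (.refl ht.isChain) rfl hN hm

theorem EssentiallyIn.of_refines (hE : IsUpperSet E) (ht : IsCandidate P x t)
    (hts : Refines P t s) (hs : NormCond H D f s) (h : EssentiallyIn E x t) :
    EssentiallyIn E x s := by
  obtain ⟨b, hb0, hb⟩ := hts
  obtain ⟨m, hm⟩ := h
  exact ⟨m, hm.of_composedAlong hE ht hb hb0 hs hb.strictMono.le_apply⟩

theorem Avoids.of_refines (ht : IsChain P t) (hts : Refines P t s) (h : Avoids E x t) :
    Avoids E x s :=
  fun r hr => h r (hts.trans ht hr)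

theorem IsSettled.of_refines (hE : IsUpperSet E) (ht : IsCandidate P x t)
    (hts : Refines P t s) (hs : NormCond H D f s) (h : IsSettled E x t) : IsSettled E x s :=
  h.imp (.of_refines hE ht hts hs) (.of_refines ht.isChain hts)

theorem EssentiallyIn.of_forall_pos (hE : IsUpperSet E) (hH : IsFinitarySeq H)
    (ht : IsCandidate P x t) (hN : NormCond H D f t) {m : ℕ}
    (h : ∀ y ∈ pos P.Sg x (seg t 0 m), EssentiallyIn E y (shift t m)) : EssentiallyIn E x t := by
  choose! n hn using h
  obtain ⟨k, hk⟩ := (((hH.seqs_finite _).subset (ht.pos_subset_seqs m)).image n).bddAbove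
  refine ⟨m + k, fun u hu => ?_⟩
  obtain ⟨hpre, hpost⟩ := ht.take_mem_pos (m.le_add_right k) hu
  obtain ⟨r, hr, hru, hrt⟩ := (hn _ hpre).mono hE (ht.shift hpre) (hN.shift m)
    (hk ⟨_, hpre, rfl⟩) u (by rwa [seg_shift_zero])
  exact ⟨r, hr, hru, hrt.trans (shift_shift t m k)⟩

/-- The condition `(y, t_m, t_{m+1}, …)`, for `y ∈ pos(w, t_0, …, t_{m-1})`. -/
def QF.tail (p : QF P f) (m : ℕ) {y : List α} (hy : y ∈ pos P.Sg p.stem (seg p.t 0 m)) : QF P f :=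
  .ofCandidate (p.isCandidate.shift hy) (p.norm_cond.shift m)

theorem QF.le_tail (p : QF P f) {m : ℕ} {y : List α}
    (hy : y ∈ pos P.Sg p.stem (seg p.t 0 m)) : p ≤ p.tail m hy :=
  QStar.le_of_composedAlong (b := fun i => m + i)
    ((ComposedAlong.refl (p.isChain.shift m)).of_shift) hy

end EssentialMembership

section Fast

variable {α : Type u} {H : ℕ → Set α} {f : ℕ → ℕ → ℕ}

theorem IsFast.monotone_right (hf : IsFast f) (k : ℕ) : Monotone (f k) :=
  monotone_nat_of_le_succ fun l => (hf k l).1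

theorem IsFast.strictMono_left (hf : IsFast f) (l : ℕ) : StrictMono fun k => f k l :=
  strictMono_nat_of_lt_succ fun k => by
    have := (hf k l).2
    omega

theorem IsHFast.pow_two_mul_phi_mul_lt (hf : IsHFast H f) (k l : ℕ) :
    2 ^ (2 * phi H l) * (f k l + 2) < f (k + 2) l := by
  have hk := hf.2.2 k l
  calc 2 ^ (2 * phi H l) * (f k l + 2) = 2 ^ phi H l * (2 ^ phi H l * (f k l + 2)) := by ring
    _ ≤ 2 ^ phi H l * (f (k + 1) l + phi H l + 2) := by
      gcongr
      calc 2 ^ phi H l * (f k l + 2) ≤ 2 ^ phi H l * (f k l + phi H l + 2) := by gcongr; omega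
        _ ≤ f (k + 1) l + phi H l + 2 := by omega
    _ < f (k + 2) l := hf.2.2 (k + 1) l

theorem IsHFast.two_mul_two_pow_le (hf : IsHFast H f) (k : ℕ) {l l' : ℕ} (hl : l ≤ l') :
    2 * 2 ^ (2 * phi H l) ≤ f (k + 2) l' :=
  calc 2 * 2 ^ (2 * phi H l) ≤ 2 ^ (2 * phi H l) * (f k l + 2) := by rw [mul_comm]; gcongr; omega
    _ ≤ f (k + 2) l := (hf.pow_two_mul_phi_mul_lt k l).le
    _ ≤ f (k + 2) l' := hf.1.monotone_right _ hl

theorem IsHFast.lt_div_two_pow (hf : IsHFast H f) (k l : ℕ) :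
    (f k l : ℝ) < f (k + 2) l / 2 ^ (2 * phi H l) := by
  rw [lt_div_iff₀' (by positivity)]
  exact_mod_cast (Nat.mul_le_mul_left _ (Nat.le_add_right _ 2)).trans_lt
    (hf.pow_two_mul_phi_mul_lt k l)

theorem IsHFast.add_phi_lt (hf : IsHFast H f) (k l : ℕ) : f k l + phi H l + 2 < f (k + 1) l :=
  (Nat.le_mul_of_pos_left _ (by positivity)).trans_lt (hf.2.2 k l)

end Fast

section NormLoss

variable {α : Type u} {H : ℕ → Set α} {D : Type v} {f : ℕ → ℕ → ℕ}
  {t s : ℕ → WeakCreature H D} {c : WeakCreature H D} {K K' M N : ℕ}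

/-- The norm of `c` is at least `2 ^ (-N)` times `f(K, m_dn(c))` or the norm of some `t_j` with
`m_dn(t_j) ≥ m_dn(c)`.  This bounds the norm which is lost in composing `c` from an end segment
of the sequence `t`. -/
def LosesAtMost (f : ℕ → ℕ → ℕ) (K N : ℕ) (t : ℕ → WeakCreature H D) (c : WeakCreature H D) :
    Prop :=
  (f K c.mdn : ℝ) / 2 ^ N < c.nor ∨ ∃ j, c.mdn ≤ (t j).mdn ∧ (t j).nor / 2 ^ N ≤ c.nor

namespace LosesAtMost

theorem self (f : ℕ → ℕ → ℕ) (K N : ℕ) (t : ℕ → WeakCreature H D) (j : ℕ) :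
    LosesAtMost f K N t (t j) :=
  .inr ⟨j, le_rfl, div_le_self (t j).nor_nonneg (one_le_pow₀ one_le_two)⟩

theorem mono (h : LosesAtMost f K N t c) (hf : IsFast f) (hK : K' ≤ K) (hN : N ≤ M) :
    LosesAtMost f K' M t c := by
  refine h.imp (fun h => lt_of_le_of_lt ?_ h) fun ⟨j, hj, h⟩ => ⟨j, hj, le_trans ?_ h⟩
  · have : f K' c.mdn ≤ f K c.mdn := (hf.strictMono_left _).monotone hK
    gcongr
    norm_num
  · have := (t j).nor_nonneg
    gcongr
    norm_num

theorem of_shift {m : ℕ} (h : LosesAtMost f K N (shift t m) c) : LosesAtMost f K N t c :=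
  h.imp_right fun ⟨j, hj⟩ => ⟨m + j, hj⟩

theorem div_pow_lt (h : LosesAtMost f K N t c) (hf : IsFast f) (hK : K' ≤ K)
    (ht : ∀ j, c.mdn ≤ (t j).mdn → (f K' (t j).mdn : ℝ) < (t j).nor) :
    (f K' c.mdn : ℝ) / 2 ^ N < c.nor := by
  rcases h.mono hf hK le_rfl with h | ⟨j, hj, h⟩
  · exact h
  · have hfj : f K' c.mdn ≤ f K' (t j).mdn := hf.monotone_right K' hj
    calc (f K' c.mdn : ℝ) / 2 ^ N ≤ f K' (t j).mdn / 2 ^ N := by gcongr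
      _ < (t j).nor / 2 ^ N := by
        have := ht j hj
        gcongr
      _ ≤ c.nor := h

theorem le_nor_mul_pow (h : LosesAtMost f K N t c) {a : ℝ} (ha : a ≤ f K c.mdn)
    (ht : ∀ j, a ≤ (t j).nor) : a ≤ c.nor * 2 ^ N := by
  rcases h with h | ⟨j, _, h⟩
  · exact ha.trans ((div_lt_iff₀ (by positivity)).1 h).le
  · exact (ht j).trans ((div_le_iff₀ (by positivity)).1 h)

theorem trans (hf : IsFast f) (h : LosesAtMost f K M s c)
    (hs : ∀ j, c.mdn ≤ (s j).mdn → LosesAtMost f K N t (s j)) :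
    LosesAtMost f K (N + M) t c := by
  rcases h with h | ⟨j, hj, h⟩
  · exact (show LosesAtMost f K M t c from .inl h).mono hf le_rfl (Nat.le_add_left M N)
  refine (hs j hj).imp (fun hsj => ?_) fun ⟨i, hi, hsj⟩ => ⟨i, hj.trans hi, ?_⟩ <;>
    rw [pow_add, ← div_div]
  · have hfj : f K c.mdn ≤ f K (s j).mdn := hf.monotone_right K hj
    calc (f K c.mdn : ℝ) / 2 ^ N / 2 ^ M ≤ f K (s j).mdn / 2 ^ N / 2 ^ M := by gcongr
      _ < (s j).nor / 2 ^ M := by gcongr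
      _ ≤ c.nor := h
  · exact (div_le_div_of_nonneg_right hsj (by positivity)).trans h

end LosesAtMost

end NormLoss

section Halving

variable {α : Type u} {H : ℕ → Set α} {D : Type v} {P : CreatingPair H D} {f : ℕ → ℕ → ℕ}
  {t r : ℕ → WeakCreature H D} {E : Set (QF P f)} {x : List α}
  {half : WeakCreature H D → WeakCreature H D}

/-- `half` is a function witnessing the Halving Property. -/
structure IsHalving (P : CreatingPair H D) (half : WeakCreature H D → WeakCreature H D) :
    Prop where
  mem_Sg : ∀ c ∈ P.K, half c ∈ P.Sg {c}
  half_nor_le : ∀ c ∈ P.K, c.nor / 2 ≤ (half c).nor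
  exists_unhalved : ∀ (n : ℕ) (t : ℕ → WeakCreature H D), IsLinked P.K t (n + 1) →
    (∀ i ≤ n, 2 ≤ (t i).nor) → ∀ c ∈ P.Sg (seg (fun i => half (t i)) 0 (n + 1)), 0 < c.nor →
      ∃ d ∈ P.Sg (seg t 0 (n + 1)), (∃ i ≤ n, (t i).nor / 2 ≤ d.nor) ∧
        ∀ u ∈ basis P.Sg (t 0), pos P.Sg u {d} ⊆ pos P.Sg u {c}

theorem CreatingPair.HasHalving.exists_isHalving (h : P.HasHalving) : ∃ half, IsHalving P half :=
  let ⟨half, hhalf, hunhalve⟩ := h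
  ⟨half, fun c hc => (hhalf c hc).1, fun c hc => (hhalf c hc).2, hunhalve⟩

namespace IsHalving

theorem composedAlong (h : IsHalving P half) (ht : IsChain P t) :
    ComposedAlong P id t fun i => half (t i) :=
  .of_forall_mem_Sg_singleton fun i => h.mem_Sg _ (ht.mem i)

theorem refines (h : IsHalving P half) (ht : IsChain P t) : Refines P t fun i => half (t i) :=
  ⟨id, rfl, h.composedAlong ht⟩

theorem losesAtMost (h : IsHalving P half) (ht : IsChain P t) (K i : ℕ) :
    LosesAtMost f K 1 t (half (t i)) :=
  .inr ⟨i, ((h.composedAlong ht).mdn_eq ht i).le, by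
    simpa only [pow_one] using h.half_nor_le _ (ht.mem i)⟩

theorem normCond (h : IsHalving P half) (hf : IsFast f) (ht : IsChain P t)
    (hN : NormCond H D f t) : NormCond H D f fun i => half (t i) := fun k => by
  filter_upwards [hN (k + 1)] with i hi
  have hhalf := h.half_nor_le _ (ht.mem i)
  have hfast : (2 * f k (t i).mdn : ℝ) < f (k + 1) (t i).mdn := by
    exact_mod_cast (hf k (t i).mdn).2
  rw [(h.composedAlong ht).mdn_eq ht i, id]
  linarith

theorem exists_unhalved_seg (h : IsHalving P half) (ht : IsChain P t) (ht2 : ∀ i, 2 ≤ (t i).nor)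
    {a b : ℕ} (hab : a < b) {c : WeakCreature H D}
    (hc : c ∈ P.Sg (seg (fun i => half (t i)) a b)) (hpos : 0 < c.nor) :
    ∃ d ∈ P.Sg (seg t a b), (∃ i, a ≤ i ∧ (t i).nor / 2 ≤ d.nor) ∧
      ∀ u ∈ basis P.Sg (t a), pos P.Sg u {d} ⊆ pos P.Sg u {c} := by
  obtain ⟨n, rfl⟩ := Nat.exists_eq_add_of_lt hab
  rw [add_assoc, ← seg_shift_zero] at hc ⊢
  obtain ⟨d, hd, ⟨i, _, hi⟩, hu⟩ := h.exists_unhalved n (shift t a) ((ht.shift a).isLinked _)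
    (fun i _ => ht2 _) c hc hpos
  exact ⟨d, hd, ⟨a + i, by omega, hi⟩, hu⟩

theorem exists_unhalved_refines (h : IsHalving P half) (ht : IsCandidate P x t)
    (ht2 : ∀ i, 2 ≤ (t i).nor) (hr : Refines P (fun i => half (t i)) r) (hpos : ∀ i, 0 < (r i).nor)
    (m : ℕ) :
    ∃ s, Refines P t s ∧ shift s m = shift r m ∧ pos P.Sg x (seg s 0 m) ⊆ pos P.Sg x (seg r 0 m) ∧
      ∀ i < m, ∃ j, (s i).mdn ≤ (t j).mdn ∧ (t j).nor / 2 ≤ (s i).nor := by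
  have hhalf := h.composedAlong ht.isChain
  have hrchain := hr.isChain (hhalf.isChain ht.isChain)
  obtain ⟨b, hb0, hb⟩ := hr
  choose d hd hdnor hdpos using fun i =>
    h.exists_unhalved_seg ht.isChain ht2 (hb.strictMono i.lt_succ_self) (hb.mem i) (hpos i)
  have hs : ComposedAlong P b t (splice m d (shift r m)) := ⟨hb.strictMono, fun i => by
    rcases lt_or_ge i m with hi | hi
    · rw [splice_of_lt hi]
      exact hd i
    · rw [splice_of_le hi, shift_apply, Nat.add_sub_cancel' hi]
      exact hhalf.Sg_subset ht.isChain (hb.strictMono i.lt_succ_self).le (hb.mem i)⟩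
  have hts : Refines P t (splice m d (shift r m)) := ⟨b, hb0, hs⟩
  refine ⟨_, hts, shift_splice m, ?_, fun i hi => ?_⟩
  · refine (ht.of_refines hts).pos_subset_pos hrchain fun n hn u hu => ?_
    have hut := hs.pos_subset ht.isChain x n.zero_le hu
    rw [hb0] at hut
    rw [splice_of_lt hn]
    exact hdpos n u (ht.pos_subset_basis _ hut)
  · obtain ⟨j, hij, hj⟩ := hdnor i
    refine ⟨j, (hs.mdn_eq ht.isChain i).trans_le (ht.strictMono.monotone hij), ?_⟩
    rwa [splice_of_lt hi]

theorem exists_essentiallyIn (h : IsHalving P half) (hE : IsUpperSet E) (ht : IsCandidate P x t)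
    (ht2 : ∀ i, 2 ≤ (t i).nor) (K : ℕ) (hhalf : ¬ Avoids E x fun i => half (t i)) :
    ∃ s, Refines P t s ∧ NormCond H D f s ∧ EssentiallyIn E x s ∧
      ∀ i, LosesAtMost f K 1 t (s i) := by
  simp only [Avoids, not_forall, not_not] at hhalf
  obtain ⟨r, hr, hpos, hNr, m, hm⟩ := hhalf
  have hhr : IsCandidate P x r := (ht.of_refines (h.refines ht.isChain)).of_refines hr
  obtain ⟨M₀, hM₀⟩ := Filter.eventually_atTop.1 (hNr K)
  obtain ⟨s, hts, hsr, hsub, hloss⟩ := h.exists_unhalved_refines ht ht2 hr hpos (max M₀ m)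
  have heq : ∀ i, max M₀ m ≤ i → s i = r i := fun i hi => by
    simpa only [shift_apply, Nat.add_sub_cancel' hi] using congrFun hsr (i - max M₀ m)
  refine ⟨s, hts, fun k => ?_, ⟨max M₀ m, fun y hy => ?_⟩, fun i => ?_⟩
  · filter_upwards [hNr k, Filter.eventually_ge_atTop (max M₀ m)] with i hi hmi
    rwa [heq i hmi]
  · rw [hsr]
    exact hm.mono hE hhr hNr (le_max_right M₀ m) y (hsub hy)
  · rcases lt_or_ge i (max M₀ m) with hi | hi
    · exact .inr (by simpa only [pow_one] using hloss i hi)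
    · rw [heq i hi]
      refine .inl (lt_of_le_of_lt ?_ (hM₀ i ((le_max_left _ _).trans hi)))
      exact div_le_self (Nat.cast_nonneg _) (one_le_pow₀ one_le_two)

end IsHalving

theorem exists_isSettled (hhalf : P.HasHalving) (hf : IsFast f) (hE : IsUpperSet E)
    (ht : IsCandidate P x t) (hN : NormCond H D f t) (ht2 : ∀ i, 2 ≤ (t i).nor) (K : ℕ) :
    ∃ s, Refines P t s ∧ NormCond H D f s ∧ IsSettled E x s ∧
      ∀ i, LosesAtMost f K 1 t (s i) := by
  obtain ⟨half, h⟩ := hhalf.exists_isHalving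
  by_cases hav : Avoids E x fun i => half (t i)
  · exact ⟨_, h.refines ht.isChain, h.normCond hf ht.isChain hN, .inr hav,
      h.losesAtMost ht.isChain K⟩
  · obtain ⟨s, hts, hs, hes, hloss⟩ := h.exists_essentiallyIn hE ht ht2 K hav
    exact ⟨s, hts, hs, .inl hes, hloss⟩

theorem exists_forall_mem_isSettled (hhalf : P.HasHalving) (hf : IsFast f)
    (hE : IsUpperSet E) (ht : IsChain P t) (hN : NormCond H D f t) {K : ℕ} (V : Finset (List α))
    (hV : ∀ y ∈ V, IsCandidate P y t) (hK : 2 * 2 ^ V.card ≤ f K (t 0).mdn)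
    (htV : ∀ j, 2 * 2 ^ V.card ≤ (t j).nor) :
    ∃ s, Refines P t s ∧ NormCond H D f s ∧ (∀ y ∈ V, IsSettled E y s) ∧
      ∀ i, LosesAtMost f K V.card t (s i) := by
  classical
  induction V using Finset.induction_on with
  | empty => exact ⟨t, .refl ht, hN, by simp, fun i => .self f K _ t i⟩
  | insert x V hx ih =>
    rw [Finset.card_insert_of_notMem hx] at hK htV ⊢
    obtain ⟨s, hts, hs, hd, hl⟩ := ih (fun y hy => hV y (Finset.mem_insert_of_mem hy))
      (le_trans (by gcongr <;> omega) hK) fun j => le_trans (by gcongr <;> norm_num) (htV j)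
    have hs2 : ∀ i, 2 ≤ (s i).nor := fun i => by
      have hmdn : (t 0).mdn ≤ (s i).mdn :=
        (hts.mdn_zero ht).symm.trans_le ((hts.isChain ht).strictMono.monotone i.zero_le)
      have hfK : (2 * 2 ^ (V.card + 1) : ℝ) ≤ f K (s i).mdn := by
        exact_mod_cast hK.trans (hf.monotone_right K hmdn)
      have hpow : (0 : ℝ) < 2 ^ V.card := by positivity
      have hle := (hl i).le_nor_mul_pow hfK htV
      rw [pow_succ] at hle
      nlinarith
    have hcand : ∀ y ∈ insert x V, IsCandidate P y s := fun y hy => (hV y hy).of_refines hts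
    obtain ⟨r, hsr, hr, hd', hl'⟩ := exists_isSettled hhalf hf hE
      (hcand x (Finset.mem_insert_self x V)) hs hs2 K
    refine ⟨r, hts.trans ht hsr, hr, fun y hy => ?_, fun i => (hl' i).trans hf fun j _ => hl j⟩
    rcases Finset.mem_insert.1 hy with rfl | hyV
    · exact hd'
    · exact (hd y hyV).of_refines hE (hcand y hy) hsr hr

end Halving

section Fusion

theorem exists_seq_of_forall_exists {X : Type*} {I : ℕ → X → Prop} {R : ℕ → X → X → Prop}
    {x₀ : X} (h₀ : I 0 x₀) (h : ∀ n x, I n x → ∃ y, I (n + 1) y ∧ R n x y) :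
    ∃ x : ℕ → X, x 0 = x₀ ∧ (∀ n, I n (x n)) ∧ ∀ n, R n (x n) (x (n + 1)) := by
  choose! F hF hR using h
  let x : ℕ → X := fun n => Nat.rec x₀ F n
  have hx : ∀ n, I n (x n) := fun n => by
    induction n with
    | zero => exact h₀
    | succ n ih => exact hF n _ ih
  exact ⟨x, rfl, hx, fun n => hR n _ (hx n)⟩

variable {α : Type u} {H : ℕ → Set α} {D : Type v} {P : CreatingPair H D} {f : ℕ → ℕ → ℕ}
  {t s r : ℕ → WeakCreature H D} {E : Set (QF P f)} {U : Set (List α)} {k K i : ℕ}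

/-- The number of halvings which have been made in the first `n` steps of a fusion: at the `i`-th
step, there is one for each possible stem of length `m_dn(t_i)`. -/
noncomputable def halvings (t : ℕ → WeakCreature H D) (n : ℕ) : ℕ :=
  ∑ i ∈ Finset.range n, phi H (t i).mdn

theorem halvings_succ (t : ℕ → WeakCreature H D) (n : ℕ) :
    halvings t (n + 1) = halvings t n + phi H (t n).mdn :=
  Finset.sum_range_succ _ n

theorem halvings_succ_le (hH : ∀ m, (H m).Nontrivial) (hfin : IsFinitarySeq H) (ht : IsChain P t)
    (n : ℕ) : halvings t (n + 1) ≤ 2 * phi H (t n).mdn :=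
  hfin.sum_phi_le hH ht.strictMono n

/-- The `i`-th step of a fusion: `t_0, …, t_{i-1}` are kept, and the norms of the remaining
creatures are halved at most `φ(m_dn(t_i))` times. -/
structure FusionStep (P : CreatingPair H D) (f : ℕ → ℕ → ℕ) (K i : ℕ)
    (t s : ℕ → WeakCreature H D) : Prop where
  eq_of_lt : ∀ j < i, s j = t j
  refines_shift : Refines P (shift t i) (shift s i)
  losesAtMost : ∀ j, i ≤ j → LosesAtMost f K (phi H (t i).mdn) t (s j)

namespace FusionStep

theorem refines (h : FusionStep P f K i t s) (ht : IsChain P t) : Refines P t s := by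
  have hs : splice i t (shift s i) = s := funext fun j => by
    rcases lt_or_ge j i with hj | hj
    · rw [splice_of_lt hj, h.eq_of_lt j hj]
    · rw [splice_of_le hj, shift_apply, Nat.add_sub_cancel' hj]
  exact hs ▸ ht.refines_splice h.refines_shift

theorem mdn_eq (h : FusionStep P f K i t s) (ht : IsChain P t) : (s i).mdn = (t i).mdn :=
  h.refines_shift.mdn_zero (ht.shift i)

theorem halvings_eq (h : FusionStep P f K i t s) (ht : IsChain P t) :
    halvings s (i + 1) = halvings t i + phi H (t i).mdn := by
  rw [halvings_succ, h.mdn_eq ht]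
  congr 1
  exact Finset.sum_congr rfl fun j hj => by rw [h.eq_of_lt j (Finset.mem_range.1 hj)]

theorem losesAtMost_trans (h : FusionStep P f K i s r) (hf : IsFast f) (hs : IsChain P s)
    (hk : k ≤ K) (hts : ∀ j, i ≤ j + 1 → LosesAtMost f k (halvings s i) t (s j)) (j : ℕ)
    (hj : i ≤ j) : LosesAtMost f k (halvings r (i + 1)) t (r j) := by
  rw [h.halvings_eq hs]
  refine ((h.losesAtMost j hj).mono hf hk le_rfl).trans hf fun j' hj' => hts j' ?_
  have hi : (s i).mdn ≤ (s j').mdn := by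
    rw [← h.mdn_eq hs]
    exact ((h.refines hs).isChain hs |>.strictMono.monotone hj).trans hj'
  exact (hs.strictMono.le_iff_le.1 hi).trans j'.le_succ

end FusionStep

theorem exists_fusionStep (hH : ∀ m, (H m).Nontrivial) (hhalf : P.HasHalving)
    (hf : IsHFast H f) (hE : IsUpperSet E) (ht : IsChain P t) (hN : NormCond H D f t)
    (hU : ∀ u ∈ U, IsCandidate P u t)
    (hL : ∀ j, i ≤ j + 1 → (f (k + 2) (t j).mdn : ℝ) / 2 ^ halvings t i < (t j).nor) :
    ∃ s, NormCond H D f s ∧ FusionStep P f (k + 2 + i) i t s ∧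
      ∀ u ∈ U, ∀ y ∈ pos P.Sg u (seg t 0 i), IsSettled E y (shift s i) := by
  set V : Set (List α) := ⋃ u ∈ U, pos P.Sg u (seg t 0 i)
  have hVs : V ⊆ seqs H (t i).mdn := Set.iUnion₂_subset fun u hu => (hU u hu).pos_subset_seqs i
  have hV : V.Finite := (hf.2.1.seqs_finite _).subset hVs
  have hcard : hV.toFinset.card ≤ phi H (t i).mdn := by
    rw [← Set.ncard_eq_toFinset_card V hV]
    exact Set.ncard_le_ncard hVs (hf.2.1.seqs_finite _)
  have hhalvings : halvings t i + phi H (t i).mdn ≤ 2 * phi H (t i).mdn :=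
    halvings_succ t i ▸ halvings_succ_le hH hf.2.1 ht i
  have hcand : ∀ y ∈ hV.toFinset, IsCandidate P y (shift t i) := fun y hy => by
    obtain ⟨u, hu, hy⟩ := Set.mem_iUnion₂.1 (hV.mem_toFinset.1 hy)
    exact (hU u hu).shift hy
  have hK : 2 * 2 ^ hV.toFinset.card ≤ f (k + 2 + i) (t i).mdn :=
    calc 2 * 2 ^ hV.toFinset.card ≤ 2 * 2 ^ (2 * phi H (t i).mdn) := by gcongr <;> omega
      _ ≤ f (k + 2) (t i).mdn := hf.two_mul_two_pow_le k le_rfl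
      _ ≤ f (k + 2 + i) (t i).mdn := (hf.1.strictMono_left _).monotone (Nat.le_add_right _ _)
  have hnor : ∀ j, (2 : ℝ) * 2 ^ hV.toFinset.card ≤ (t (i + j)).nor := fun j => by
    refine le_trans ?_ (hL (i + j) (by omega)).le
    rw [le_div_iff₀ (by positivity), mul_assoc, ← pow_add]
    calc (2 : ℝ) * 2 ^ (hV.toFinset.card + halvings t i) ≤ 2 * 2 ^ (2 * phi H (t i).mdn) := by
          gcongr
          · norm_num
          · omega
      _ ≤ f (k + 2) (t (i + j)).mdn := by
          exact_mod_cast hf.two_mul_two_pow_le k (ht.strictMono.monotone (i.le_add_right j))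
  obtain ⟨s, hts, hs, hsettled, hloss⟩ := exists_forall_mem_isSettled hhalf hf.1 hE (ht.shift i)
    (hN.shift i) hV.toFinset hcand hK hnor
  refine ⟨splice i t s, hs.splice i, ⟨fun j => splice_of_lt, by rwa [shift_splice],
    fun j hj => ?_⟩, fun u hu y hy => ?_⟩
  · rw [splice_of_le hj]
    exact (hloss (j - i)).of_shift.mono hf.1 le_rfl hcard
  · rw [shift_splice]
    exact hsettled y (hV.mem_toFinset.2 (Set.mem_biUnion hu hy))

/-- A sequence of successive fusion steps. -/
structure IsFusion (P : CreatingPair H D) (f : ℕ → ℕ → ℕ) (k : ℕ)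
    (X : ℕ → ℕ → WeakCreature H D) : Prop where
  isChain : ∀ n, IsChain P (X n)
  normCond : ∀ n, NormCond H D f (X n)
  step : ∀ n, FusionStep P f (k + n) n (X n) (X (n + 1))

/-- The limit of a fusion: its `i`-th creature does not change after the `i`-th step. -/
def fusionLimit (X : ℕ → ℕ → WeakCreature H D) : ℕ → WeakCreature H D := fun i => X (i + 1) i

namespace IsFusion

variable {X : ℕ → ℕ → WeakCreature H D}

theorem fusionLimit_eq (h : IsFusion P f k X) {i n : ℕ} (hin : i < n) :
    fusionLimit X i = X n i := by
  induction n, (show i + 1 ≤ n from hin) using Nat.le_induction with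
  | base => rfl
  | succ n hn ih => rw [(h.step n).eq_of_lt i hn, ih hn]

theorem refines (h : IsFusion P f k X) (n : ℕ) : Refines P (X 0) (X n) := by
  induction n with
  | zero => exact .refl (h.isChain 0)
  | succ n ih => exact ih.trans (h.isChain 0) ((h.step n).refines (h.isChain n))

theorem refines_fusionLimit (h : IsFusion P f k X) (n : ℕ) : Refines P (X n) (fusionLimit X) :=
  .of_eventuallyEq h.isChain (fun n => (h.step n).refines (h.isChain n)) (fun i => by
    filter_upwards [Filter.eventually_gt_atTop i] with m hm using (h.fusionLimit_eq hm).symm) n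

theorem losesAtMost (h : IsFusion P f k X) (hf : IsFast f) {m n : ℕ} (hmn : m ≤ n) (j : ℕ)
    (hj : n ≤ j + 1) : LosesAtMost f (k + m) (halvings (X n) n) (X m) (X n j) := by
  induction n, hmn using Nat.le_induction generalizing j with
  | base => exact .self f _ _ _ j
  | succ n hmn ih =>
    exact (h.step n).losesAtMost_trans hf (h.isChain n) (by omega) ih j (by omega)

theorem losesAtMost_fusionLimit (h : IsFusion P f k X) (hH : ∀ m, (H m).Nontrivial)
    (hf : IsHFast H f) {m : ℕ} (hi : m ≤ i) :
    LosesAtMost f (k + m) (2 * phi H (fusionLimit X i).mdn) (X m) (fusionLimit X i) :=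
  (h.losesAtMost hf.1 (hi.trans i.le_succ) i le_rfl).mono hf.1 le_rfl
    (halvings_succ_le hH hf.2.1 (h.isChain (i + 1)) i)

theorem lt_nor_fusionLimit (h : IsFusion P f (k + 2) X) (hH : ∀ m, (H m).Nontrivial)
    (hf : IsHFast H f) (hX : ∀ j, (f (k + 2) (X 0 j).mdn : ℝ) < (X 0 j).nor) (i : ℕ) :
    (f k (fusionLimit X i).mdn : ℝ) < (fusionLimit X i).nor :=
  (hf.lt_div_two_pow k _).trans <|
    (h.losesAtMost_fusionLimit hH hf i.zero_le).div_pow_lt hf.1 le_rfl fun j _ => hX j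

theorem normCond_fusionLimit (h : IsFusion P f k X) (hH : ∀ m, (H m).Nontrivial)
    (hf : IsHFast H f) : NormCond H D f (fusionLimit X) := fun K => by
  obtain ⟨N, hN⟩ := Filter.eventually_atTop.1 (h.normCond (K + 2) (K + 2))
  have hlim := (h.refines_fusionLimit 0).isChain (h.isChain 0)
  filter_upwards [Filter.eventually_ge_atTop (K + 2),
    hlim.strictMono.tendsto_atTop.eventually_ge_atTop (X (K + 2) N).mdn] with i hi hNi
  refine (hf.lt_div_two_pow K _).trans ((h.losesAtMost_fusionLimit hH hf hi).div_pow_lt hf.1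
    (Nat.le_add_left _ _) fun j hj => hN j ?_)
  exact (h.isChain (K + 2)).strictMono.le_iff_le.1 (hNi.trans hj)

end IsFusion

theorem exists_isFusion (hH : ∀ m, (H m).Nontrivial) (hhalf : P.HasHalving)
    (hf : IsHFast H f) (hE : IsUpperSet E) (ht : IsChain P t) (hN : NormCond H D f t)
    (hU : ∀ u ∈ U, IsCandidate P u t)
    (hn : ∀ j, (f (k + 2) (t j).mdn : ℝ) < (t j).nor) :
    ∃ X, X 0 = t ∧ IsFusion P f (k + 2) X ∧
      ∀ n, ∀ u ∈ U, ∀ y ∈ pos P.Sg u (seg (X n) 0 n), IsSettled E y (shift (X (n + 1)) n) := by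
  obtain ⟨X, hX0, hX, hstep⟩ := exists_seq_of_forall_exists
    (I := fun n T => Refines P t T ∧ NormCond H D f T ∧
      ∀ j, n ≤ j + 1 → LosesAtMost f (k + 2) (halvings T n) t (T j))
    (R := fun n T S => FusionStep P f (k + 2 + n) n T S ∧
      ∀ u ∈ U, ∀ y ∈ pos P.Sg u (seg T 0 n), IsSettled E y (shift S n))
    (x₀ := t) ⟨.refl ht, hN, fun j _ => .self f _ _ t j⟩ (by
      rintro n T ⟨htT, hT, hloss⟩
      have hTchain := htT.isChain ht
      obtain ⟨S, hS, hstep, hsettled⟩ := exists_fusionStep hH hhalf hf hE hTchain hT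
        (fun u hu => (hU u hu).of_refines htT)
        fun j hj => (hloss j hj).div_pow_lt hf.1 le_rfl fun i _ => hn i
      exact ⟨S, ⟨htT.trans ht (hstep.refines hTchain), hS, fun j hj =>
        hstep.losesAtMost_trans hf.1 hTchain (Nat.le_add_right _ _) hloss j (by omega)⟩,
        hstep, hsettled⟩)
  exact ⟨X, hX0, ⟨fun n => (hX n).1.isChain ht, fun n => (hX n).2.1, fun n => (hstep n).1⟩,
    fun n => (hstep n).2⟩

theorem exists_forall_pos_isSettled (hH : ∀ m, (H m).Nontrivial) (hhalf : P.HasHalving)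
    (hf : IsHFast H f) (hE : IsUpperSet E) (ht : IsChain P t) (hN : NormCond H D f t)
    (hU : ∀ u ∈ U, IsCandidate P u t)
    (hn : ∀ j, (f (k + 2) (t j).mdn : ℝ) < (t j).nor) :
    ∃ s, Refines P t s ∧ NormCond H D f s ∧ (∀ i, (f k (s i).mdn : ℝ) < (s i).nor) ∧
      ∀ m, ∀ u ∈ U, ∀ y ∈ pos P.Sg u (seg s 0 m), IsSettled E y (shift s m) := by
  obtain ⟨X, rfl, hX, hsettled⟩ := exists_isFusion hH hhalf hf hE ht hN hU hn
  have hs := hX.normCond_fusionLimit hH hf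
  refine ⟨fusionLimit X, hX.refines_fusionLimit 0, hs, hX.lt_nor_fusionLimit hH hf hn,
    fun m u hu y hy => ?_⟩
  have hseg : ∀ n, m ≤ n → seg (fusionLimit X) 0 m = seg (X n) 0 m := fun n hn =>
    seg_congr fun i _ hi => hX.fusionLimit_eq (hi.trans_le hn)
  have hcand := ((hU u hu).of_refines (hX.refines (m + 1))).shift (hseg (m + 1) m.le_succ ▸ hy)
  exact (hsettled m u hu y (hseg m le_rfl ▸ hy)).of_refines hE hcand
    ((hX.refines_fusionLimit (m + 1)).shift (hX.isChain _) rfl) (hs.shift m)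

end Fusion

section Bigness

variable {α : Type u} {H : ℕ → Set α} {D : Type v} {P : CreatingPair H D} {f : ℕ → ℕ → ℕ}
  {t s : ℕ → WeakCreature H D} {E : Set (QF P f)} {U : Set (List α)} {x u : List α}

theorem CreatingPair.IsBig.exists_forall_or_forall_not (hbig : P.IsBig fun _ => 2)
    {c : WeakCreature H D} (hc : c ∈ P.K) (hu : u ∈ basis P.Sg c) (hn : 1 < c.nor)
    (Q : List α → Prop) :
    ∃ d ∈ P.Sg {c}, c.nor - 1 ≤ d.nor ∧
      ((∀ y ∈ pos P.Sg u {d}, Q y) ∨ ∀ y ∈ pos P.Sg u {d}, ¬ Q y) := by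
  classical
  obtain ⟨d, hd, hdn, a, ha⟩ := hbig c hc hn u hu fun y => if Q y then 0 else 1
  have hcolour : ∀ y ∈ pos P.Sg u {d}, (if Q y then (0 : Fin 2) else 1) = a := fun y hy =>
    ha ⟨y, pos_singleton_subset_of_mem_Sg hc hd u hy⟩ hy
  refine ⟨d, hd, hdn, ?_⟩
  by_cases h0 : a = 0
  · exact .inl fun y hy => by simpa [h0] using hcolour y hy
  · exact .inr fun y hy hQ => h0 (by simpa [hQ, eq_comm] using hcolour y hy)

theorem CreatingPair.IsBig.exists_homogeneous (hbig : P.IsBig fun _ => 2)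
    {c : WeakCreature H D} (hc : c ∈ P.K) (Q : List α → Prop) (V : Finset (List α))
    (hV : ∀ x ∈ V, x ∈ basis P.Sg c) (hn : V.card < c.nor) :
    ∃ d ∈ P.Sg {c}, c.nor - V.card ≤ d.nor ∧
      ∀ x ∈ V, (∀ y ∈ pos P.Sg x {d}, Q y) ∨ ∀ y ∈ pos P.Sg x {d}, ¬ Q y := by
  classical
  induction V using Finset.induction_on with
  | empty => exact ⟨c, P.Sg_self c hc, by simp, by simp⟩
  | insert x V hx ih =>
    rw [Finset.card_insert_of_notMem hx] at hn ⊢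
    push_cast at hn ⊢
    obtain ⟨d, hd, hdn, hdV⟩ := ih (fun y hy => hV y (Finset.mem_insert_of_mem hy)) (by linarith)
    have hdK : d ∈ P.K :=
      P.Sg_subset _ (Set.singleton_subset_iff.2 hc) (Set.countable_singleton c) hd
    obtain ⟨e, he, hen, hex⟩ := hbig.exists_forall_or_forall_not hdK
      (P.basis_subset_of_mem_Sg_singleton hc hd (hV x (Finset.mem_insert_self x V)))
      (by linarith) Q
    refine ⟨e, P.Sg_singleton_subset hc hd he, by linarith, fun y hy => ?_⟩
    rcases Finset.mem_insert.1 hy with rfl | hy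
    · exact hex
    · have hsub := pos_singleton_subset_of_mem_Sg hdK he y
      exact (hdV y hy).imp (fun h z hz => h z (hsub hz)) fun h z hz => h z (hsub hz)

theorem CreatingPair.IsBig.exists_homogeneous_seq (hbig : P.IsBig fun _ => 2)
    (hH : IsFinitarySeq H) (ht : IsCandidate P x t)
    (hn : ∀ i, (phi H (t i).mdn : ℝ) < (t i).nor) (Q : ℕ → List α → Prop) :
    ∃ s : ℕ → WeakCreature H D, (∀ i, s i ∈ P.Sg {t i}) ∧
      (∀ i, (t i).nor - phi H (t i).mdn ≤ (s i).nor) ∧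
      ∀ i, ∀ u ∈ pos P.Sg x (seg t 0 i),
        (∀ y ∈ pos P.Sg u {s i}, Q i y) ∨ ∀ y ∈ pos P.Sg u {s i}, ¬ Q i y := by
  have h : ∀ i, ∃ d ∈ P.Sg {t i}, (t i).nor - phi H (t i).mdn ≤ d.nor ∧
      ∀ u ∈ pos P.Sg x (seg t 0 i),
        (∀ y ∈ pos P.Sg u {d}, Q i y) ∨ ∀ y ∈ pos P.Sg u {d}, ¬ Q i y := fun i => by
    have hV := (hH.seqs_finite _).subset (ht.pos_subset_seqs i)
    have hcard : (hV.toFinset.card : ℝ) ≤ phi H (t i).mdn := by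
      rw [← Set.ncard_eq_toFinset_card _ hV]
      exact_mod_cast Set.ncard_le_ncard (ht.pos_subset_seqs i) (hH.seqs_finite _)
    obtain ⟨d, hd, hdn, hdV⟩ := hbig.exists_homogeneous (ht.mem i) (Q i) hV.toFinset
      (fun u hu => ht.pos_subset_basis i (hV.mem_toFinset.1 hu)) (hcard.trans_lt (hn i))
    exact ⟨d, hd, by linarith, fun u hu => hdV u (hV.mem_toFinset.2 hu)⟩
  choose s hs hsn hsh using h
  exact ⟨s, hs, hsn, hsh⟩

theorem IsHFast.normCond_of_sub_phi_le (hf : IsHFast H f) (ht : NormCond H D f t)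
    (hmdn : ∀ i, (s i).mdn = (t i).mdn)
    (hs : ∀ i, (t i).nor - phi H (t i).mdn ≤ (s i).nor) : NormCond H D f s := fun k => by
  filter_upwards [ht (k + 1)] with i hi
  have hfast : (f k (t i).mdn + phi H (t i).mdn + 2 : ℝ) < f (k + 1) (t i).mdn := by
    exact_mod_cast hf.add_phi_lt k (t i).mdn
  rw [hmdn]
  linarith [hs i]

theorem Avoids.exists_not_essentiallyIn (hE : IsUpperSet E) (hH : IsFinitarySeq H)
    (ht : IsCandidate P x t) (hN : NormCond H D f t) (hpos : ∀ i, 0 < (t i).nor)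
    (h : Avoids E x t) {d : WeakCreature H D} (hd : d ∈ P.Sg {t 0}) (hd0 : 0 < d.nor) :
    ∃ y ∈ pos P.Sg x {d}, ¬ EssentiallyIn E y (shift t 1) := by
  by_contra! hess
  set s := splice 1 (fun _ => d) (shift t 1)
  have hsucc : ∀ i, s (i + 1) = t (i + 1) := fun i => by
    rw [add_comm]
    exact splice_add 1 i
  have hs : Refines P t s := .of_forall_mem_Sg_singleton fun i => by
    cases i with
    | zero => exact hd
    | succ i => exact hsucc i ▸ P.Sg_self _ (ht.mem _)
  have hNs : NormCond H D f s := (hN.shift 1).splice 1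
  refine h s hs (fun i => ?_) hNs ?_
  · cases i with
    | zero => exact hd0
    | succ i => exact hsucc i ▸ hpos (i + 1)
  · refine .of_forall_pos hE hH (ht.of_refines hs) hNs (m := 1) fun y hy => ?_
    rw [shift_splice]
    rw [seg_splice le_rfl, seg_succ] at hy
    exact hess y hy

theorem Avoids.of_mem_pos (hE : IsUpperSet E) (hH : IsFinitarySeq H)
    (ht : IsCandidate P x t) (hN : NormCond H D f t) (htpos : ∀ i, 0 < (t i).nor)
    (hsettled : ∀ m, ∀ y ∈ pos P.Sg x (seg t 0 m), IsSettled E y (shift t m))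
    (hs : ∀ i, s i ∈ P.Sg {t i}) (hspos : ∀ i, 0 < (s i).nor)
    (hhom : ∀ i, ∀ u ∈ pos P.Sg x (seg t 0 i),
      (∀ y ∈ pos P.Sg u {s i}, EssentiallyIn E y (shift t (i + 1))) ∨
        ∀ y ∈ pos P.Sg u {s i}, ¬ EssentiallyIn E y (shift t (i + 1)))
    (h : Avoids E x t) (m : ℕ) : ∀ y ∈ pos P.Sg x (seg s 0 m), Avoids E y (shift t m) := by
  have hts : ComposedAlong P id t s := .of_forall_mem_Sg_singleton hs
  have hsub : ∀ n, pos P.Sg x (seg s 0 n) ⊆ pos P.Sg x (seg t 0 n) := fun n =>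
    hts.pos_subset ht.isChain x n.zero_le
  induction m with
  | zero =>
    intro y hy
    rw [seg_self, pos_empty, Set.mem_singleton_iff] at hy
    rwa [hy, shift_zero]
  | succ m ih =>
    intro y hy
    obtain ⟨hpre, hlast⟩ := (ht.of_refines ⟨id, rfl, hts⟩).take_mem_pos m.le_succ hy
    rw [seg_succ] at hlast
    obtain ⟨z, hz, hnot⟩ := (ih _ hpre).exists_not_essentiallyIn hE hH (ht.shift (hsub m hpre))
      (hN.shift m) (fun i => htpos (m + i)) (hs m) (hspos m)
    rw [shift_shift] at hnot
    refine (hsettled (m + 1) y (hsub _ hy)).resolve_left ?_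
    exact (hhom m _ (hsub m hpre)).resolve_left (fun hess => hnot (hess z hz)) y hlast

theorem IsDenseSet.exists_not_avoids (hd : IsDenseSet E) (hE : IsUpperSet E) (p : QF P f) :
    ∃ m, ∃ y ∈ pos P.Sg p.stem (seg p.t 0 m), ¬ Avoids E y (shift p.t m) := by
  obtain ⟨q, hqE, hpq⟩ := hd p
  obtain ⟨b, hb, hst⟩ := QStar.exists_composedAlong_of_le hpq
  obtain ⟨n, hn⟩ := Filter.eventually_atTop.1 (q.norm_cond 0)
  obtain ⟨y, hy⟩ := q.isCandidate.pos_nonempty n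
  refine ⟨b n, y, p.isChain.pos_trans (Nat.zero_le _) (hb.strictMono.monotone n.zero_le) hst
    (hb.pos_subset p.isChain _ n.zero_le hy), fun hav => hav (shift q.t n) ?_ (fun i => ?_)
    (q.norm_cond.shift n) ⟨0, fun z hz => ?_⟩⟩
  · exact (hb.shift le_rfl).refines (p.isChain.shift _) (hb.mdn_eq p.isChain n)
  · exact (Nat.cast_nonneg _).trans_lt (hn (n + i) (n.le_add_right i))
  · rw [seg_self, pos_empty, Set.mem_singleton_iff] at hz
    exact ⟨q.tail n hy, hE (q.le_tail hy) hqE, hz.symm, (shift_zero _).symm⟩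

theorem IsDenseSet.not_avoids_of_forall_isSettled (hd : IsDenseSet E) (hE : IsUpperSet E)
    (hbig : P.IsBig fun _ => 2) (hf : IsHFast H f) (ht : IsCandidate P x t)
    (hN : NormCond H D f t) {k : ℕ} (hn : ∀ i, (f (k + 1) (t i).mdn : ℝ) < (t i).nor)
    (hsettled : ∀ m, ∀ y ∈ pos P.Sg x (seg t 0 m), IsSettled E y (shift t m)) :
    ¬ Avoids E x t := by
  intro hav
  have hphi : ∀ i, (phi H (t i).mdn : ℝ) < (t i).nor := fun i =>
    lt_of_le_of_lt (by exact_mod_cast (by linarith [hf.add_phi_lt k (t i).mdn])) (hn i)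
  obtain ⟨s, hs, hsn, hhom⟩ := hbig.exists_homogeneous_seq hf.2.1 ht hphi
    fun i y => EssentiallyIn E y (shift t (i + 1))
  have hts : Refines P t s := .of_forall_mem_Sg_singleton hs
  have hmdn : ∀ i, (s i).mdn = (t i).mdn :=
    (ComposedAlong.of_forall_mem_Sg_singleton hs).mdn_eq ht.isChain
  obtain ⟨m, y, hy, hnot⟩ := hd.exists_not_avoids hE (QStar.ofCandidate (ht.of_refines hts)
    (hf.normCond_of_sub_phi_le hN hmdn hsn))
  refine hnot (Avoids.of_refines (ht.isChain.shift m) (hts.shift ht.isChain (hmdn m)) ?_)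
  exact hav.of_mem_pos hE hf.2.1 ht hN (fun i => (Nat.cast_nonneg _).trans_lt (hphi i)) hsettled
    hs (fun i => (sub_pos.2 (hphi i)).trans_le (hsn i)) hhom m y hy

theorem IsDenseSet.exists_essentiallyIn (hd : IsDenseSet E) (hE : IsUpperSet E)
    (hH : ∀ m, (H m).Nontrivial) (hbig : P.IsBig fun _ => 2) (hhalf : P.HasHalving)
    (hf : IsHFast H f) (ht : IsChain P t) (hN : NormCond H D f t)
    (hU : ∀ u ∈ U, IsCandidate P u t) {k : ℕ}
    (hn : ∀ j, (f (k + 3) (t j).mdn : ℝ) < (t j).nor) :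
    ∃ s, Refines P t s ∧ NormCond H D f s ∧ (∀ i, (f (k + 1) (s i).mdn : ℝ) < (s i).nor) ∧
      ∀ u ∈ U, EssentiallyIn E u s := by
  obtain ⟨s, hts, hNs, hns, hsettled⟩ := exists_forall_pos_isSettled hH hhalf hf hE ht hN hU hn
  refine ⟨s, hts, hNs, hns, fun u hu => ?_⟩
  have hroot := hsettled 0 u hu u (IsCandidate.mem_pos_zero u)
  rw [shift_zero] at hroot
  exact hroot.resolve_right (hd.not_avoids_of_forall_isSettled hE hbig hf
    ((hU u hu).of_refines hts) hNs hns fun m => hsettled m u hu)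

end Bigness

section Limits

variable {α : Type u} {H : ℕ → Set α} {D : Type v} {P : CreatingPair H D} {f : ℕ → ℕ → ℕ}
  {E : Set (QF P f)}

theorem IsFast.cast_le_cast (hf : IsFast f) {k k' : ℕ} (hk : k ≤ k') (l : ℕ) :
    (f k l : ℝ) ≤ f k' l := by
  exact_mod_cast (hf.strictMono_left l).monotone hk

namespace QF

/-- The least `i` such that `nor[t^p_i] > f(k, m_dn(t^p_i))`, as in the definition of `≤^f_k`. -/
noncomputable def start (k : ℕ) (p : QF P f) : ℕ :=
  sInf {i : ℕ | (f k (p.t i).mdn : ℝ) < (p.t i).nor}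

theorem lt_nor_start (k : ℕ) (p : QF P f) :
    (f k (p.t (start k p)).mdn : ℝ) < (p.t (start k p)).nor :=
  Nat.sInf_mem (s := {i : ℕ | (f k (p.t i).mdn : ℝ) < (p.t i).nor}) (p.norm_cond k).exists

theorem start_le_of_lt_nor {k : ℕ} {p : QF P f} {i : ℕ}
    (h : (f k (p.t i).mdn : ℝ) < (p.t i).nor) : start k p ≤ i :=
  Nat.sInf_le h

theorem start_le_start (hf : IsFast f) {k k' : ℕ} (hk : k ≤ k') {p q : QF P f}
    (h : ∀ j ≤ start k p, p.t j = q.t j) : start k p ≤ start k' q := by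
  by_contra! hlt
  refine hlt.not_ge (start_le_of_lt_nor ?_)
  rw [h _ hlt.le]
  exact (hf.cast_le_cast hk _).trans_lt (lt_nor_start k' q)

theorem LEn.le {n : ℕ} {p q : QF P f} (h : LEn n p q) : p ≤ q := by
  cases n with
  | zero => exact h.1
  | succ n => exact h.1.1

theorem LEn.stem_eq {n : ℕ} {p q : QF P f} (h : LEn n p q) : p.stem = q.stem := by
  cases n with
  | zero => exact h.2
  | succ n => exact h.1.2

theorem LEn.of_succ (hf : IsFast f) {n : ℕ} {p q : QF P f} (h : LEn (n + 1) p q) :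
    LEn n p q := by
  cases n with
  | zero => exact h.1
  | succ n =>
    exact ⟨h.1, fun j hj => h.2.1 j (hj.trans (start_le_start hf (Nat.le_succ _) fun _ _ => rfl)),
      fun i hi => h.2.2 i (hi.trans (hf.cast_le_cast (Nat.le_succ _) _))⟩

end QF

theorem EssentiallyIn.of_lEn (hE : IsUpperSet E) {n : ℕ} {p q : QF P f}
    (hp : EssentiallyIn E p.stem p.t) (h : QF.LEn n p q) : EssentiallyIn E q.stem q.t := by
  rw [← h.stem_eq]
  exact hp.of_refines hE p.isCandidate (QStar.refines_of_le h.le h.stem_eq) q.norm_cond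

theorem IsDenseSet.exists_lEn_essentiallyIn (hd : IsDenseSet E) (hE : IsUpperSet E)
    (hH : ∀ m, (H m).Nontrivial) (hbig : P.IsBig fun _ => 2) (hhalf : P.HasHalving)
    (hf : IsHFast H f) (p : QF P f) (k : ℕ) :
    ∃ q : QF P f, QF.LEn (k + 1) p q ∧ EssentiallyIn E q.stem q.t := by
  obtain ⟨n, hn⟩ := Filter.eventually_atTop.1 (p.norm_cond (k + 3))
  set m := max n (QF.start (k + 1) p + 1)
  obtain ⟨s, hs, hNs, hns, hess⟩ := hd.exists_essentiallyIn hE hH hbig hhalf hf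
    (U := pos P.Sg p.stem (seg p.t 0 m)) (p.isChain.shift m) (p.norm_cond.shift m)
    (fun u hu => p.isCandidate.shift hu)
    (fun j => hn (m + j) ((le_max_left _ _).trans (Nat.le_add_right _ _)))
  have hts : Refines P p.t (splice m p.t s) := p.isChain.refines_splice hs
  have hcand := p.isCandidate.of_refines hts
  refine ⟨.ofCandidate hcand (hNs.splice m), ⟨⟨QStar.le_of_refines hts rfl, rfl⟩,
    fun j hj => (splice_of_lt ?_).symm, fun i hi => ?_⟩, ?_⟩
  · exact (Nat.lt_succ_of_le hj).trans_le (le_max_right n _)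
  · rcases lt_or_ge i m with him | him
    · exact ⟨i, (splice_of_lt him).symm⟩
    · change (splice m p.t s i).nor ≤ f (k + 1) (splice m p.t s i).mdn at hi
      rw [splice_of_le him] at hi
      exact absurd (hns _) hi.not_gt
  · refine .of_forall_pos hE hf.2.1 hcand (hNs.splice m) (m := m) fun y hy => ?_
    change y ∈ pos P.Sg p.stem (seg (splice m p.t s) 0 m) at hy
    change EssentiallyIn E y (shift (splice m p.t s) m)
    rw [seg_splice le_rfl] at hy
    rw [shift_splice]
    exact hess y hy

/-- A sequence of conditions `q_0, q_1, …` with `q_n ≤^f_{k+n+1} q_{n+1}` for all `n`. -/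
def IsFusionSeq (k : ℕ) (q : ℕ → QF P f) : Prop :=
  ∀ n, QF.LEn (k + n + 1) (q n) (q (n + 1))

namespace IsFusionSeq

variable {k : ℕ} {q : ℕ → QF P f} {s : ℕ → WeakCreature H D}

theorem monotone_start (hq : IsFusionSeq k q) (hf : IsFast f) :
    Monotone fun n => QF.start (k + n + 1) (q n) :=
  monotone_nat_of_le_succ fun n => QF.start_le_start hf (Nat.le_succ _) (hq n).2.1

theorem stem_eq (hq : IsFusionSeq k q) (n : ℕ) : (q n).stem = (q 0).stem := by
  induction n with
  | zero => rfl
  | succ n ih => rw [← (hq n).stem_eq, ih]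

theorem t_eq_of_le_start (hq : IsFusionSeq k q) (hf : IsFast f) {n j : ℕ}
    (hj : j ≤ QF.start (k + n + 1) (q n)) {m : ℕ} (hm : n ≤ m) : (q m).t j = (q n).t j := by
  induction m, hm using Nat.le_induction with
  | base => rfl
  | succ m hm ih => rw [← (hq m).2.1 j (hj.trans (hq.monotone_start hf hm)), ih]

theorem exists_le_start (hq : IsFusionSeq k q) (hf : IsFast f) (i : ℕ) :
    ∃ n, i ≤ QF.start (k + n + 1) (q n) := by
  induction i with
  | zero => exact ⟨0, Nat.zero_le _⟩
  | succ i ih =>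
    obtain ⟨n, hn⟩ := ih
    by_contra! hstuck
    have hnor : ∀ m, n ≤ m → (m : ℝ) < ((q n).t i).nor := fun m hm => by
      have hstart : QF.start (k + m + 1) (q m) = i :=
        le_antisymm (Nat.lt_succ_iff.1 (hstuck m)) (hn.trans (hq.monotone_start hf hm))
      have hlt := QF.lt_nor_start (k + m + 1) (q m)
      rw [hstart, hq.t_eq_of_le_start hf hn hm] at hlt
      have hle : m ≤ f (k + m + 1) ((q n).t i).mdn :=
        (show m ≤ k + m + 1 by omega).trans (hf.strictMono_left _).le_apply
      exact lt_of_le_of_lt (by exact_mod_cast hle) hlt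
    obtain ⟨m, hm⟩ := exists_nat_ge ((q n).t i).nor
    refine (hnor (max n m) (le_max_left n m)).not_ge (hm.trans ?_)
    exact_mod_cast le_max_right n m

theorem exists_eventually_eq (hq : IsFusionSeq k q) (hf : IsFast f) :
    ∃ s : ℕ → WeakCreature H D, ∀ i, ∀ᶠ n in Filter.atTop, (q n).t i = s i := by
  choose N hN using hq.exists_le_start hf
  exact ⟨fun i => (q (N i)).t i,
    fun i => Filter.eventually_atTop.2 ⟨N i, fun m => hq.t_eq_of_le_start hf (hN i)⟩⟩

theorem mem_range_of_nor_le (hq : IsFusionSeq k q) (hf : IsFast f) {n m : ℕ} (hnm : n ≤ m)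
    {x : WeakCreature H D} (hx : x ∈ Set.range (q m).t) (hnor : x.nor ≤ f (k + n + 1) x.mdn) :
    x ∈ Set.range (q n).t := by
  induction m, hnm using Nat.le_induction with
  | base => exact hx
  | succ m hm ih =>
    obtain ⟨i, rfl⟩ := hx
    exact ih ((hq m).2.2 i (hnor.trans (hf.cast_le_cast (by omega) _)))

theorem limit_mem_range_of_nor_le (hq : IsFusionSeq k q) (hf : IsFast f)
    (hs : ∀ i, ∀ᶠ n in Filter.atTop, (q n).t i = s i) {n i : ℕ}
    (hi : (s i).nor ≤ f (k + n + 1) (s i).mdn) : s i ∈ Set.range (q n).t := by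
  obtain ⟨m, hm, hnm⟩ := ((hs i).and (Filter.eventually_ge_atTop n)).exists
  exact hq.mem_range_of_nor_le hf hnm ⟨i, hm⟩ hi

theorem limit_t_eq (hq : IsFusionSeq k q) (hf : IsFast f)
    (hs : ∀ i, ∀ᶠ n in Filter.atTop, (q n).t i = s i) {n j : ℕ}
    (hj : j ≤ QF.start (k + n + 1) (q n)) : (q n).t j = s j := by
  obtain ⟨m, hm, hnm⟩ := ((hs j).and (Filter.eventually_ge_atTop n)).exists
  rw [← hm, hq.t_eq_of_le_start hf hj hnm]

theorem refines_limit (hq : IsFusionSeq k q)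
    (hs : ∀ i, ∀ᶠ n in Filter.atTop, (q n).t i = s i) (n : ℕ) : Refines P (q n).t s :=
  .of_eventuallyEq (fun n => (q n).isChain)
    (fun n => QStar.refines_of_le (hq n).le (hq n).stem_eq) hs n

theorem limit_normCond (hq : IsFusionSeq k q) (hf : IsFast f)
    (hs : ∀ i, ∀ᶠ n in Filter.atTop, (q n).t i = s i) : NormCond H D f s := fun K => by
  obtain ⟨M, hM⟩ := Filter.eventually_atTop.1 ((q K).norm_cond K)
  refine Filter.eventually_atTop.2 ⟨((q K).t M).mdn, fun i hi => ?_⟩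
  by_contra! hsmall
  obtain ⟨j, hj⟩ := hq.limit_mem_range_of_nor_le hf hs (n := K)
    (hsmall.trans (hf.cast_le_cast (by omega) _))
  have hij : i ≤ (s i).mdn :=
    ((hq.refines_limit hs 0).isChain (q 0).isChain).strictMono.le_apply
  rw [← hj] at hsmall hij
  exact (hM j ((q K).isChain.strictMono.le_iff_le.1 (hi.trans hij))).not_ge hsmall

theorem exists_limit (hq : IsFusionSeq k q) (hf : IsFast f) :
    ∃ r : QF P f, ∀ n, QF.LEn (k + n + 1) (q n) r := by
  obtain ⟨s, hs⟩ := hq.exists_eventually_eq hf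
  exact ⟨.ofCandidate ((q 0).isCandidate.of_refines (hq.refines_limit hs 0))
      (hq.limit_normCond hf hs),
    fun n => ⟨⟨QStar.le_of_refines (hq.refines_limit hs n) (hq.stem_eq n), hq.stem_eq n⟩,
      fun j hj => hq.limit_t_eq hf hs hj, fun i hi => hq.limit_mem_range_of_nor_le hf hs hi⟩⟩

end IsFusionSeq

end Limits

section Properness

variable {Q : Type u} [Preorder Q]

theorem isCountableClub_closed {X : Type u} {Φ : X → X → Set X}
    (hΦ : ∀ x y, (Φ x y).Countable) :
    IsCountableClub {A : Set X | A.Countable ∧ ∀ x ∈ A, ∀ y ∈ A, Φ x y ⊆ A} := by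
  refine ⟨fun A hA => hA.1, fun A hA => ?_, fun A hA hAC => ⟨?_, fun x hx y hy => ?_⟩⟩
  · let step : Set X → Set X := fun S => S ∪ ⋃ x ∈ S, ⋃ y ∈ S, Φ x y
    have hmono : Monotone fun n => step^[n] A := monotone_nat_of_le_succ fun n => by
      rw [Function.iterate_succ_apply']
      exact Set.subset_union_left
    have hcount : ∀ n, (step^[n] A).Countable := fun n => by
      induction n with
      | zero => exact hA
      | succ n ih =>
        rw [Function.iterate_succ_apply']
        exact ih.union (ih.biUnion fun x _ => ih.biUnion fun y _ => hΦ x y)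
    refine ⟨⋃ n, step^[n] A, ⟨Set.countable_iUnion hcount, fun x hx y hy z hz => ?_⟩,
      Set.subset_iUnion (fun n => step^[n] A) 0⟩
    obtain ⟨m, hm⟩ := Set.mem_iUnion.1 hx
    obtain ⟨n, hn⟩ := Set.mem_iUnion.1 hy
    refine Set.mem_iUnion.2 ⟨max m n + 1, ?_⟩
    rw [Function.iterate_succ_apply']
    exact Or.inr (Set.mem_biUnion (hmono (le_max_left m n) hm)
      (Set.mem_biUnion (hmono (le_max_right m n) hn) hz))
  · exact Set.countable_iUnion fun n => (hAC n).1
  · obtain ⟨m, hm⟩ := Set.mem_iUnion.1 hx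
    obtain ⟨n, hn⟩ := Set.mem_iUnion.1 hy
    exact ((hAC (max m n)).2 x (hA (le_max_left m n) hm) y (hA (le_max_right m n) hn)).trans
      (Set.subset_iUnion A _)

/-- The set `W` is predense above `q`: each condition above `q` is compatible with some element
of `W`. -/
def IsPredenseAbove (W : Set Q) (q : Q) : Prop :=
  ∀ r, q ≤ r → ∃ d ∈ W, ∃ s, r ≤ s ∧ d ≤ s

theorem IsPredenseAbove.mono {V W : Set Q} {q : Q} (h : IsPredenseAbove V q) (hVW : V ⊆ W) :
    IsPredenseAbove W q := fun r hr =>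
  let ⟨d, hd, hs⟩ := h r hr
  ⟨d, hVW hd, hs⟩

theorem exists_isGenericFor {R : ℕ → Q → Q → Prop}
    (hlim : ∀ q : ℕ → Q, (∀ n, R n (q n) (q (n + 1))) → ∃ r, ∀ n, q n ≤ r)
    {N : Set (Q ⊕ Set Q)} (hN : N.Countable)
    (hstep : ∀ A, Sum.inr A ∈ N → IsDenseSet A → ∀ p, Sum.inl p ∈ N → ∀ n,
      ∃ q, Sum.inl q ∈ N ∧ R n p q ∧ IsPredenseAbove {d ∈ A | Sum.inl d ∈ N} q)
    {p : Q} (hp : Sum.inl p ∈ N) : ∃ r, p ≤ r ∧ IsGenericFor N r := by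
  set 𝒜 : Set (Set Q) := {A | Sum.inr A ∈ N ∧ IsDenseSet A}
  have hcount : 𝒜.Countable := (hN.preimage Sum.inr_injective).mono fun A hA => hA.1
  rcases 𝒜.eq_empty_or_nonempty with hempty | hne
  · exact ⟨p, le_rfl, fun A hAN hA => (hempty.le ⟨hAN, hA⟩ : A ∈ (∅ : Set (Set Q))).elim⟩
  obtain ⟨e, he⟩ := hcount.exists_eq_range hne
  have hmem : ∀ n, e n ∈ 𝒜 := fun n => he ▸ ⟨n, rfl⟩
  obtain ⟨q, rfl, -, hq⟩ := exists_seq_of_forall_exists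
    (I := fun _ (q : Q) => (Sum.inl q : Q ⊕ Set Q) ∈ N)
    (R := fun n q q' => R n q q' ∧ IsPredenseAbove {d ∈ e n | Sum.inl d ∈ N} q') hp
    (fun n q hqN => hstep (e n) (hmem n).1 (hmem n).2 q hqN n)
  obtain ⟨r, hr⟩ := hlim q fun n => (hq n).1
  refine ⟨r, hr 0, fun A hAN hA s hs => ?_⟩
  obtain ⟨n, rfl⟩ : A ∈ Set.range e := he ▸ ⟨hAN, hA⟩
  obtain ⟨d, ⟨hd, hdN⟩, hds⟩ := (hq n).2 s ((hr (n + 1)).trans hs)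
  exact ⟨d, hd, hdN, hds⟩

theorem isProperForcing_of_fusion {R : ℕ → Q → Q → Prop}
    (hlim : ∀ q : ℕ → Q, (∀ n, R n (q n) (q (n + 1))) → ∃ r, ∀ n, q n ≤ r)
    (hdense : ∀ A : Set Q, IsDenseSet A → ∀ p n,
      ∃ q, R n p q ∧ ∃ W ⊆ A, W.Countable ∧ IsPredenseAbove W q) :
    IsProperForcing Q := by
  have hwitness : ∀ (p : Q) (A : Set Q), ∃ S : Set Q, S.Countable ∧
      (IsDenseSet A → ∀ n, ∃ q ∈ S, R n p q ∧ IsPredenseAbove (A ∩ S) q) := fun p A => by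
    by_cases hA : IsDenseSet A
    · choose q hpq W hWA hW hWq using hdense A hA p
      refine ⟨⋃ n, insert (q n) (W n), Set.countable_iUnion fun n => (hW n).insert _,
        fun _ n => ⟨q n, Set.mem_iUnion.2 ⟨n, Set.mem_insert _ _⟩, hpq n, ?_⟩⟩
      exact (hWq n).mono fun d hd => ⟨hWA n hd, Set.mem_iUnion.2 ⟨n, Set.mem_insert_of_mem _ hd⟩⟩
    · exact ⟨∅, Set.countable_empty, fun h => absurd h hA⟩
  choose S hS hSstep using hwitness
  let Φ : Q ⊕ Set Q → Q ⊕ Set Q → Set (Q ⊕ Set Q) :=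
    Sum.elim (fun p => Sum.elim (fun _ => ∅) fun A => Sum.inl '' S p A) fun _ _ => ∅
  have hΦ : ∀ x y, (Φ x y).Countable := by
    rintro (p | _) (_ | A)
    exacts [Set.countable_empty, (hS p A).image _, Set.countable_empty, Set.countable_empty]
  refine ⟨_, isCountableClub_closed hΦ, fun N ⟨hN, hclosed⟩ p hp =>
    exists_isGenericFor hlim hN (fun A hAN hA q hqN n => ?_) hp⟩
  have hSN : ∀ d ∈ S q A, Sum.inl d ∈ N := fun d hd => hclosed _ hqN _ hAN ⟨d, hd, rfl⟩
  obtain ⟨r, hr, hqr, hpre⟩ := hSstep q A hA n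
  exact ⟨r, hSN r hr, hqr, hpre.mono fun d hd => ⟨hd.1, hSN d hd.2⟩⟩

theorem IsDenseSet.upperClosure {A : Set Q} (hA : IsDenseSet A) :
    IsDenseSet (upperClosure A : Set Q) := fun p =>
  let ⟨d, hd, hpd⟩ := hA p
  ⟨d, subset_upperClosure hd, hpd⟩

end Properness

section Names

variable {Q : Type u} [Preorder Q]

theorem OrdName.Forces.mono {τ : OrdName.{u, w} Q} {p q : Q} {o : Ordinal.{w}}
    (h : τ.Forces p o) (hpq : p ≤ q) : τ.Forces q o := fun r hr => h r (hpq.trans hr)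

theorem OrdName.isUpperSet_decidedBy (τ : OrdName.{u, w} Q) : IsUpperSet {p | τ.DecidedBy p} :=
  fun _ _ hpq ⟨o, ho⟩ => ⟨o, ho.mono hpq⟩

theorem OrdName.isDenseSet_decidedBy (τ : OrdName.{u, w} Q) :
    IsDenseSet {p | τ.DecidedBy p} := fun p =>
  let ⟨r, hpr, x, hx, hxr⟩ := τ.exists_value p
  ⟨r, ⟨x.2, fun q hrq => ⟨q, le_rfl, x.1, hxr.trans hrq, hx⟩⟩, hpr⟩

end Names

section DenseSets

variable {α : Type u} {H : ℕ → Set α} {D : Type v} {P : CreatingPair H D} {f : ℕ → ℕ → ℕ}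

theorem EssentiallyIn.essentiallyDecides {τ : OrdName.{max u v, w} (QF P f)} {q : QF P f}
    (h : EssentiallyIn {r | τ.DecidedBy r} q.stem q.t) : q.EssentiallyDecides τ := by
  obtain ⟨m, hm⟩ := h
  refine ⟨m, fun x hx => ?_⟩
  obtain ⟨r, hr, hstem, ht⟩ := hm x hx
  exact ⟨r, hstem, fun i => by rw [ht, shift_apply], hr⟩

theorem QF.exists_tail_le {p q : QF P f} (h : p ≤ q) (m : ℕ) :
    ∃ (y : List α) (hy : y ∈ pos P.Sg p.stem (seg p.t 0 m)) (r : QF P f),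
      q ≤ r ∧ p.tail m hy ≤ r := by
  obtain ⟨b, hb, hstem⟩ := QStar.exists_composedAlong_of_le h
  obtain ⟨z, hz⟩ := q.isCandidate.pos_nonempty m
  have hbm : m ≤ b m := hb.strictMono.le_apply
  have hzp : z ∈ pos P.Sg p.stem (seg p.t 0 (b m)) :=
    p.isChain.pos_trans (Nat.zero_le _) (hb.strictMono.monotone (Nat.zero_le m)) hstem
      (hb.pos_subset p.isChain _ (Nat.zero_le m) hz)
  obtain ⟨hpre, hpost⟩ := p.isCandidate.take_mem_pos hbm hzp
  refine ⟨_, hpre, q.tail m hz, q.le_tail hz, QStar.le_of_composedAlong (hb.shift hbm) ?_⟩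
  change z ∈ pos P.Sg _ (seg (shift p.t m) 0 (b (m + 0) - m))
  rwa [seg_shift_zero, add_zero, Nat.add_sub_cancel' hbm]

theorem EssentiallyIn.exists_countable_isPredenseAbove (hH : IsFinitarySeq H) {A : Set (QF P f)}
    {q : QF P f} (h : EssentiallyIn (upperClosure A : Set (QF P f)) q.stem q.t) :
    ∃ W ⊆ A, W.Countable ∧ IsPredenseAbove W q := by
  obtain ⟨m, hm⟩ := h
  have hbelow : ∀ y : pos P.Sg q.stem (seg q.t 0 m), ∃ d ∈ A, d ≤ q.tail m y.2 := by
    rintro ⟨y, hy⟩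
    obtain ⟨r, hr, hstem, ht⟩ := hm y hy
    obtain rfl : r = q.tail m hy := QStar.ext hstem ht
    exact mem_upperClosure.1 hr
  choose d hdA hd using hbelow
  have : Finite (pos P.Sg q.stem (seg q.t 0 m)) :=
    (hH.seqs_finite _).subset (q.isCandidate.pos_subset_seqs m)
  refine ⟨Set.range d, Set.range_subset_iff.2 hdA, Set.countable_range d, fun r hr => ?_⟩
  obtain ⟨y, hy, s, hrs, hs⟩ := QF.exists_tail_le hr m
  exact ⟨d ⟨y, hy⟩, Set.mem_range_self _, s, hrs, (hd ⟨y, hy⟩).trans hs⟩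

theorem exists_lEn_forall_essentiallyIn (hH : ∀ m, (H m).Nontrivial)
    (hbig : P.IsBig fun _ => 2) (hhalf : P.HasHalving) (hf : IsHFast H f)
    {E : ℕ → Set (QF P f)} (hd : ∀ m, IsDenseSet (E m)) (hE : ∀ m, IsUpperSet (E m))
    (p : QF P f) (n : ℕ) :
    ∃ q : QF P f, QF.LEn n p q ∧ ∀ m, EssentiallyIn (E m) q.stem q.t := by
  obtain ⟨q, rfl, -, hq⟩ := exists_seq_of_forall_exists (I := fun _ _ => True)
    (R := fun m (q q' : QF P f) =>
      QF.LEn (n + m + 1) q q' ∧ EssentiallyIn (E m) q'.stem q'.t) (x₀ := p) trivial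
    fun m q _ =>
      let ⟨q', hq'⟩ := (hd m).exists_lEn_essentiallyIn (hE m) hH hbig hhalf hf q (n + m)
      ⟨q', trivial, hq'⟩
  have hfusion : IsFusionSeq n q := fun m => (hq m).1
  obtain ⟨r, hr⟩ := hfusion.exists_limit hf.1
  exact ⟨r, (hr 0).of_succ hf.1, fun m => (hq m).2.of_lEn (hE m) (hr (m + 1))⟩

theorem QF.isProperForcing (hH : ∀ m, (H m).Nontrivial) (hbig : P.IsBig fun _ => 2)
    (hhalf : P.HasHalving) (hf : IsHFast H f) : IsProperForcing (QF P f) := by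
  refine isProperForcing_of_fusion (R := fun n => QF.LEn (0 + n + 1)) (fun q hq => ?_)
    fun A hA p n => ?_
  · have hfusion : IsFusionSeq 0 q := hq
    obtain ⟨r, hr⟩ := hfusion.exists_limit hf.1
    exact ⟨r, fun n => (hr n).le⟩
  · obtain ⟨q, hpq, hq⟩ := hA.upperClosure.exists_lEn_essentiallyIn (upperClosure A).upper
      hH hbig hhalf hf p (0 + n)
    exact ⟨q, hpq, hq.exists_countable_isPredenseAbove hf.2.1⟩

end DenseSets

end Creatures

theorem mainTheorem10_general {α : Type u} {H : ℕ → Set α} {D : Type v}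
    (hH : ∀ m, (H m).Nontrivial)
    (P : Creatures.CreatingPair H D)
    (hbig : P.IsBig fun _ => 2) (hhalf : P.HasHalving)
    (f : ℕ → ℕ → ℕ) (hf : Creatures.IsHFast H f) :
    (∀ (τ : ℕ → Creatures.OrdName.{max u v, w} (Creatures.QF P f))
        (p : Creatures.QF P f) (n : ℕ),
      ∃ q : Creatures.QF P f, Creatures.QF.LEn n p q ∧ ∀ m, q.EssentiallyDecides (τ m)) ∧
    Creatures.IsProperForcing (Creatures.QF P f) := by
  refine ⟨fun τ p n => ?_, Creatures.QF.isProperForcing hH hbig hhalf hf⟩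
  obtain ⟨q, hpq, hq⟩ := Creatures.exists_lEn_forall_essentiallyIn hH hbig hhalf hf
    (fun m => (τ m).isDenseSet_decidedBy) (fun m => (τ m).isUpperSet_decidedBy) p n
  exact ⟨q, hpq, fun m => (hq m).essentiallyDecides⟩

theorem mainTheorem10 {α : Type u} {H : ℕ → Set α} {D : Type v}
    (hH : ∀ m, (H m).Nontrivial)
    (P : Creatures.CreatingPair H D) (hfin : P.IsFinitary)
    (hbig : P.IsBig fun _ => 2) (hhalf : P.HasHalving)
    (hsg : P.IsSimple ∨ P.IsGluing)
    (f : ℕ → ℕ → ℕ) (hf : Creatures.IsHFast H f) :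
    (∀ (τ : ℕ → Creatures.OrdName.{max u v, w} (Creatures.QF P f))
        (p : Creatures.QF P f) (n : ℕ),
      ∃ q : Creatures.QF P f, Creatures.QF.LEn n p q ∧ ∀ m, q.EssentiallyDecides (τ m)) ∧
    Creatures.IsProperForcing (Creatures.QF P f) :=
  mainTheorem10_general hH P hbig hhalf f hf
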